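/- Let $H_\mu(p,q)=\tfrac12|p+iq|^2-\frac{\mu}{|q-(1-\mu)|}-\frac{1-\mu}{|q+\mu|}-\tfrac12|q|^2$ be the Hamiltonian of the circular planar restricted three-body problem in rotating coordinates, with $p,q\in\mathbb R^2=\mathbb C$, the earth at $-\mu$ and the moon at $1-\mu$. Let $l_1(\mu)$ be the critical point of $H_\mu$ whose position lies strictly between the primaries, and let $L_1(\mu)=H_\mu(l_1(\mu))$. Let $$q_1=\tfrac12-\mu+\tfrac12\cosh x_1\cos x_2,\qquad q_2=\tfrac12\sinh x_1\sin x_2,$$ $$\begin{pmatrix}p_1\\ p_2\end{pmatrix}=\frac{2}{\cosh^2x_1-\cos^2x_2}\begin{pmatrix}\sinh x_1\cos x_2&-\cosh x_1\sin x_2\\ \cosh x_1\sin x_2&\sinh x_1\cos x_2\end{pmatrix}\begin{pmatrix}y_1\\ y_2\end{pmatrix}-\begin{pmatrix}0\\ \tfrac12-\mu\end{pmatrix}$$ be elliptic-hyperbolic coordinates, and let $\hat H_{\mu,E}:\mathbb R^4\to\mathbb R$ be the smooth extension across the collisions of $\tfrac14(\cosh^2x_1-\cos^2x_2)\,(H_\mu(p,q)-E)$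 as a function of $(y_1,y_2,x_1,x_2)$. For a primary (earth $e$ or moon $m$) and $E\le L_1(\mu)$, a lift $\widetilde{\mathcal M}^{e}_{\mu,E}$ (respectively $\widetilde{\mathcal M}^{m}_{\mu,E}$) to $\mathbb R^4$ of the regularized component $\mathcal M^{e}_{\mu,E}$ (respectively $\mathcal M^{m}_{\mu,E}$) is the closure of a connected component of the set of regular points of $\hat H_{\mu,E}^{-1}(0)$ which contains a collision with that primary. Let $S$ be the set of points of the lift that lie over $l_1(\mu)$. The component $\mathcal M^{e}_{\mu,E}$ (respectively $\mathcal M^{m}_{\mu,E}$) is called strictly convex if lifts exist and, for every lift, (a) the lift is the boundary of a compact convex subset of $\mathbb R^4$ with non-empty interior, and (b) at every point of the lift outside $S$, the differential of $\hat H_{\mu,E}$ is non-zero and all sectional curvatures of the lift, with the metric induced from $\mathbb R^4$, are positive. **Theorem 1.7.** For $\mu=\tfrac12$ the point $l_1(\tfrac12)$ exists and is unique, $L_1(\tfrac12)=-2$, and for every $E\le L_1(\tfrac12)=-2$ the regularized components $\mathcal M^e_{1/2,E}$ and $\mathcal M^m_{1/2,E}$ are strictly convex. Moreover, for every lift, $S=\emptyset$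 if $E<-2$, while for $E=-2$ the set $S$ consists of exactly two points, both of them saddle-centers of $\hat H_{1/2,-2}$: critical points at which the linearized Hamiltonian vector field has one pair of non-zero real eigenvalues $\pm\lambda$ and one pair of non-zero imaginary eigenvalues $\pm i\omega$. -/

import Mathlib

open Real Set InnerProductSpace

/-- Four-dimensional Euclidean space. Points of the physical phase space are written
`(p₁, p₂, q₁, q₂)`, points of the regularized phase space `(y₁, y₂, x₁, x₂)`. -/
abbrev E4 : Type := EuclideanSpace ℝ (Fin 4)

noncomputable section

/-! ### The circular planar restricted three-body problem in rotating coordinates -/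

/-- The two primaries: the earth, of mass `1 - μ`, and the moon, of mass `μ`. -/
inductive Primary : Type
  | earth
  | moon

/-- The primary sits at the point `(a, 0)` of the plane, `a = -μ` or `a = 1 - μ`. -/
def Primary.abscissa (μ : ℝ) : Primary → ℝ
  | .earth => -μ
  | .moon => 1 - μ

/-- `H_μ(p,q) = ½|p + iq|² - μ/|q - (1-μ)| - (1-μ)/|q + μ| - ½|q|²`, where
`p + iq = (p₁ - q₂) + i (p₂ + q₁)`. -/
def hamiltonian (μ : ℝ) (z : E4) : ℝ :=
  ((z 0 - z 3) ^ 2 + (z 1 + z 2) ^ 2) / 2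
    - μ / √((z 2 - (1 - μ)) ^ 2 + z 3 ^ 2)
    - (1 - μ) / √((z 2 + μ) ^ 2 + z 3 ^ 2)
    - (z 2 ^ 2 + z 3 ^ 2) / 2

/-- `l` is the first Lagrange point: the critical point of `H_μ` whose position lies on the open
segment between the primaries. Its value under `H_μ` is the first Lagrange value `L₁(μ)`. -/
def IsFirstLagrangePoint (μ : ℝ) (l : E4) : Prop :=
  l 3 = 0 ∧ -μ < l 2 ∧ l 2 < 1 - μ ∧ gradient (hamiltonian μ) l = 0

/-! ### Regularization by elliptic-hyperbolic coordinates -/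

/-- `cosh² x₁ - cos² x₂`; it vanishes exactly at the collisions with the primaries. -/
def ellipticFactor (z : E4) : ℝ := cosh (z 2) ^ 2 - cos (z 3) ^ 2

/-- First coordinate `q₁` of the position (the midpoint of the primaries is `½ - μ`). -/
def ellipticQ₁ (μ : ℝ) (z : E4) : ℝ := (1 / 2 - μ) + cosh (z 2) * cos (z 3) / 2

/-- Second coordinate `q₂` of the position. -/
def ellipticQ₂ (z : E4) : ℝ := sinh (z 2) * sin (z 3) / 2

/-- The symplectic map `(y, x) ↦ (p, q)` given by elliptic-hyperbolic coordinates, meaningful where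
`ellipticFactor z ≠ 0`. It is invariant under `(y, x) ↦ -(y, x)` and under
`x₂ ↦ x₂ + 2π`. -/
def ellipticMap (μ : ℝ) (z : E4) : E4 :=
  !₂[2 / ellipticFactor z * (sinh (z 2) * cos (z 3) * z 0 - cosh (z 2) * sin (z 3) * z 1),
     2 / ellipticFactor z * (cosh (z 2) * sin (z 3) * z 0 + sinh (z 2) * cos (z 3) * z 1)
       - (1 / 2 - μ),
     ellipticQ₁ μ z,
     ellipticQ₂ z]

/-- The regularized Hamiltonian on `ℝ⁴`, the universal cover of `ℝ² × (ℝ × ℝ/2πℤ)`. It is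
the smooth extension across the collisions of `¼ (cosh² x₁ - cos² x₂) (H_μ(p,q) - E)`,
see `regHamiltonian_eq`. -/
def regHamiltonian (μ E : ℝ) (z : E4) : ℝ :=
  ((z 0 + sin (2 * z 3) / 8) ^ 2 + (z 1 + sinh (2 * z 2) / 8) ^ 2) / 2
    + (-(E * cosh (z 2) ^ 2) / 4 - cosh (z 2) / 2 - sinh (2 * z 2) ^ 2 / 128
        + E * cos (z 3) ^ 2 / 4 - sin (2 * z 3) ^ 2 / 128)
    + (1 - 2 * μ) * (cos (z 3) / 2
        - (1 / 2 - μ + cosh (z 2) * cos (z 3)) * (cosh (z 2) ^ 2 - cos (z 3) ^ 2) / 16)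

/-- Away from the collisions, the zero level of `regHamiltonian μ E` is the preimage of the
energy surface `H_μ = E`. -/
theorem regHamiltonian_eq (μ E : ℝ) (z : E4) (hz : ellipticFactor z ≠ 0) :
    regHamiltonian μ E z = ellipticFactor z / 4 * (hamiltonian μ (ellipticMap μ z) - E) := by
  have hc : 1 ≤ cosh (z 2) := one_le_cosh _
  have hk := cos_le_one (z 3)
  have hk' := neg_one_le_cos (z 3)
  have hs : sinh (z 2) ^ 2 = cosh (z 2) ^ 2 - 1 := sinh_sq _
  have ht : sin (z 3) ^ 2 = 1 - cos (z 3) ^ 2 := sin_sq _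
  have e1 : √((ellipticQ₁ μ z - (1 - μ)) ^ 2 + ellipticQ₂ z ^ 2)
      = (cosh (z 2) - cos (z 3)) / 2 := by
    rw [← Real.sqrt_sq (by linarith : (0 : ℝ) ≤ (cosh (z 2) - cos (z 3)) / 2)]
    congr 1
    simp only [ellipticQ₁, ellipticQ₂, div_pow, mul_pow, hs, ht]
    ring
  have e2 : √((ellipticQ₁ μ z + μ) ^ 2 + ellipticQ₂ z ^ 2)
      = (cosh (z 2) + cos (z 3)) / 2 := by
    rw [← Real.sqrt_sq (by linarith : (0 : ℝ) ≤ (cosh (z 2) + cos (z 3)) / 2)]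
    congr 1
    simp only [ellipticQ₁, ellipticQ₂, div_pow, mul_pow, hs, ht]
    ring
  have hf : ellipticFactor z = (cosh (z 2) - cos (z 3)) * (cosh (z 2) + cos (z 3)) := by
    simp only [ellipticFactor]; ring
  have h1 : cosh (z 2) - cos (z 3) ≠ 0 := fun h => hz (by rw [hf, h, zero_mul])
  have h2 : cosh (z 2) + cos (z 3) ≠ 0 := fun h => hz (by rw [hf, h, mul_zero])
  have m0 : ellipticMap μ z 0 = 2 / ellipticFactor z *
      (sinh (z 2) * cos (z 3) * z 0 - cosh (z 2) * sin (z 3) * z 1) := rfl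
  have m1 : ellipticMap μ z 1 = 2 / ellipticFactor z *
      (cosh (z 2) * sin (z 3) * z 0 + sinh (z 2) * cos (z 3) * z 1) - (1 / 2 - μ) := rfl
  have m2 : ellipticMap μ z 2 = ellipticQ₁ μ z := rfl
  have m3 : ellipticMap μ z 3 = ellipticQ₂ z := rfl
  simp only [hamiltonian, m0, m1, m2, m3, e1, e2]
  simp only [hf, regHamiltonian, ellipticQ₁, ellipticQ₂, Real.sin_two_mul, Real.sinh_two_mul]
  generalize cosh (z 2) = c at *
  generalize cos (z 3) = k at *
  generalize sinh (z 2) = s at *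
  generalize sin (z 3) = t at *
  generalize z 0 = a
  generalize z 1 = b
  field_simp
  grind

/-- The regular points of the regularized energy surface, lifted to `ℝ⁴`. -/
def regularPart (μ E : ℝ) : Set E4 :=
  {z | regHamiltonian μ E z = 0 ∧ gradient (regHamiltonian μ E) z ≠ 0}

/-- `M` is a component of the lift to `ℝ⁴` of the regularized component around the primary `a`:
the closure of a connected component of the set of regular points of the regularized energy surface
that contains a collision with `a`. For energies below the first Lagrange value every point of `M`
is regular and `M` is a connected component of the regularized energy surface; at the first Lagrange
value the components around the two primaries meet at the singularities over the first
Lagrange point, and taking the regular points first separates them. -/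
def IsLiftedComponent (μ E : ℝ) (a : Primary) (M : Set E4) : Prop :=
  ∃ z ∈ regularPart μ E, ellipticQ₁ μ z = a.abscissa μ ∧ ellipticQ₂ z = 0 ∧
    M = closure (connectedComponentIn (regularPart μ E) z)

/-- The points of `M` that lie over the first Lagrange point. (Such points are never collisions,
because the first Lagrange point lies strictly between the primaries.) -/
def singularSet (μ : ℝ) (M : Set E4) : Set E4 :=
  {z ∈ M | IsFirstLagrangePoint μ (ellipticMap μ z)}

/-- The Hamiltonian vector field `(ẏ, ẋ) = (-∂G/∂x, ∂G/∂y)`. -/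
def hamiltonianField (G : E4 → ℝ) (z : E4) : E4 :=
  !₂[-(gradient G z 2), -(gradient G z 3), gradient G z 0, gradient G z 1]

/-- A saddle-center: an equilibrium whose linearized Hamiltonian vector field has one pair of
nonzero real eigenvalues `± lam` and one pair of nonzero imaginary eigenvalues `± i om`. -/
def IsSaddleCenter (G : E4 → ℝ) (z : E4) : Prop :=
  gradient G z = 0 ∧ ∃ lam om : ℝ, 0 < lam ∧ 0 < om ∧
    (fderiv ℝ (hamiltonianField G) z : E4 →ₗ[ℝ] E4).charpoly =
      (Polynomial.X ^ 2 - Polynomial.C (lam ^ 2)) * (Polynomial.X ^ 2 + Polynomial.C (om ^ 2))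

/-! ### Curvature of the level sets of a function on `ℝ⁴`, with the induced metric -/

/-- The unit normal field of the level sets of `G`. -/
def unitNormal (G : E4 → ℝ) (w : E4) : E4 := ‖gradient G w‖⁻¹ • gradient G w

/-- Orthogonal projection of `v` to the tangent space at `w` of the level set of `G` through `w`. -/
def tangentialPart (G : E4 → ℝ) (w v : E4) : E4 := v - inner ℝ (unitNormal G w) v • unitNormal G w

/-- The Levi-Civita connection `∇_X Y` of the metric induced on the level sets of `G`, for vector
fields `X`, `Y` tangent to the level sets: the tangential part of the derivative of `Y` along `X`. -/
def leviCivita (G : E4 → ℝ) (X Y : E4 → E4) (w : E4) : E4 :=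
  tangentialPart G w (fderiv ℝ Y w (X w))

/-- The Riemann curvature `R(X,Y)Z = ∇_X ∇_Y Z - ∇_Y ∇_X Z - ∇_[X,Y] Z` of the level sets of `G`. -/
def riemannCurvature (G : E4 → ℝ) (X Y Z : E4 → E4) (w : E4) : E4 :=
  leviCivita G X (leviCivita G Y Z) w - leviCivita G Y (leviCivita G X Z) w
    - leviCivita G (VectorField.lieBracket ℝ X Y) Z w

/-- The sectional curvature `⟨R(u,v)v, u⟩ / (|u|²|v|² - ⟨u,v⟩²)` at a regular point `z` of the level
set of `G` through `z`, for the plane spanned by linearly independent tangent vectors `u`, `v`,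
which are extended to vector fields tangent to the level sets by projection. -/
def sectionalCurvature (G : E4 → ℝ) (z u v : E4) : ℝ :=
  inner ℝ
      (riemannCurvature G (fun w => tangentialPart G w u) (fun w => tangentialPart G w v)
        (fun w => tangentialPart G w v) z) u
    / (‖u‖ ^ 2 * ‖v‖ ^ 2 - inner ℝ u v ^ 2)

/-- Near `z` the set `{G = G z}` is a smooth hypersurface (`G` being smooth) all of whose sectional
curvatures at `z` are positive. -/
def HasPositiveCurvatureAt (G : E4 → ℝ) (z : E4) : Prop :=
  gradient G z ≠ 0 ∧ ∀ u v : E4, inner ℝ (gradient G z) u = 0 → inner ℝ (gradient G z) v = 0 →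
    LinearIndependent ℝ ![u, v] → 0 < sectionalCurvature G z u v

/-! ### Strict convexity -/

/-- `M` bounds a convex subset of `ℝ⁴`: it is the boundary of a convex body. -/
def BoundsConvex (M : Set E4) : Prop :=
  ∃ B : Set E4, Convex ℝ B ∧ IsCompact B ∧ (interior B).Nonempty ∧ frontier B = M

/-- The regularized component around the primary `a` is strictly convex: its lift to `ℝ⁴` bounds a
convex subset and has positive sectional curvatures away from the points over the first
Lagrange point. -/
def IsStrictlyConvexComponent (μ E : ℝ) (a : Primary) : Prop :=
  (∃ M, IsLiftedComponent μ E a M) ∧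
    ∀ M, IsLiftedComponent μ E a M →
      BoundsConvex M ∧ ∀ z ∈ M \ singularSet μ M, HasPositiveCurvatureAt (regHamiltonian μ E) z

end

/-! For equal masses the regularized Hamiltonian is `(η² + ζ²)/2 + V(x₁) + W(x₂)`, where `η`, `ζ`
are the sheared momenta, `V`, `W` are `hypPotential`, `trigPotential`, and `e = -E/4 ≥ 1/2`. Both
claims, convexity and positive curvature, follow once the Hessian is positive on the tangent spaces
of the zero level around the collision `x = 0`, singular points excepted.

In adapted coordinates the Hessian is `α² + a s² + β² + b t²` and the differential is `η α + W' s +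
ζ β + V' t`, with `a = trigCurvature`, `b = hypCurvature`. Always `b > 0`. If `a ≤ 0`,
Cauchy-Schwarz reduces the claim to `W'² + a (η² + ζ² + V'²/b) > 0`. The variables are decoupled
through `l = V + ζ²/2 = -W - η²/2`: one shows `V'² ≤ b (2V + (9/4) l²)` and `W'² + a (-2W + (9/4)
l²) > 0`, and adds, since `η² + ζ² + 2V = -2W`. For `e = 1/2`, `V'²` agrees with `2 V V''` and `W'²`
with `2 W W''` to leading order over the Lagrange point; hence a correction quadratic in `l`, and
`9/4` leaves room on both sides (`hyperbolic_defect_bound`, `trigonometric_defect_pos`).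

Local positivity gives global convexity by a Tietze-type argument (`convex_of_hessian_pos`): the
well is connected, and its possible singular boundary points, at `|x₂| = π/2`, never lie inside a
segment joining points of the well. The regular part of the boundary is connected by radial
projection, and every lift is a translate of it by a multiple of `π` in `x₂`, followed by closure.
Positive curvature is the Gauss equation. -/

/-! ### Polynomial inequalities in the hyperbolic variable -/

/-- A product of powers is bounded by its value at the far corner of a box, keeping two factors `u`. -/
theorem sq_mul_pow_le (u y : ℝ) (hu : 0 ≤ u) (hu1 : u ≤ 9/20) (hy : 0 ≤ y) (hy1 : y ≤ 1/2) (i j : ℕ) :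
    u^(i+2)*y^j ≤ u^2*((9/20)^i*(1/2)^j) ∧ 0 ≤ u^(i+2)*y^j := by
  refine ⟨?_, by positivity⟩
  have h1 : u^i ≤ (9/20)^i := pow_le_pow_left₀ hu hu1 i
  have h2 : y^j ≤ (1/2)^j := pow_le_pow_left₀ hy hy1 j
  calc u^(i+2)*y^j = u^2*(u^i*y^j) := by ring
    _ ≤ u^2*((9/20)^i*(1/2)^j) := by gcongr

/-- This is the coefficient of `d = e - 1/2` in the defect of `hyperbolic_defect_bound`, with `cosh
x₁ = 1 + u` and `y = ζ²`; the next two lemmas treat `d²` and `d³`. Comparing the monomials divisible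
by `u²` with `u²` times a corner value leaves a linear problem. -/
theorem hyperbolic_coeff_one_nonneg (u y : ℝ) (hu : 0 ≤ u) (hu1 : u ≤ 9/20) (hy : 0 ≤ y) (hy1 : y ≤ 1/2) :
    0 ≤ (7/8 + 2425/512*u + 14925/1024*u^2 + 25813/1024*u^3 + 34809/2048*u^4 - 27239/2048*u^5 - 32871/1024*u^6 - 20541/1024*u^7 - 4203/2048*u^8 + 5121/2048*u^9 + 891/1024*u^10 + 81/1024*u^11) + ( - 1/64 + 21/16*u + 357/128*u^2 - 469/32*u^3 - 3057/64*u^4 - 3237/64*u^5 - 1387/64*u^6 - 45/32*u^7 + 63/32*u^8 + 45/64*u^9 + 9/128*u^10)*y + ( - 9/8*u - 81/8*u^2 - 81/4*u^3 - 135/8*u^4 - 27/4*u^5 - 9/8*u^6)*y^2 := by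
  have b := sq_mul_pow_le u y hu hu1 hy hy1
  have h1 : u^2 ≤ 9/20*u := by nlinarith
  have h2 : 0 ≤ u*y := mul_nonneg hu hy
  have h3 : u*y ≤ 1/2*u := by nlinarith
  have h4 : u*y^2 ≤ 1/4*u := by nlinarith [mul_nonneg hu (mul_nonneg hy (sub_nonneg.2 hy1))]
  have b1 := b 1 0
  have b2 := b 2 0
  have b3 := b 3 0
  have b4 := b 4 0
  have b5 := b 5 0
  have b6 := b 6 0
  have b7 := b 7 0
  have b8 := b 8 0
  have b9 := b 9 0
  have b10 := b 0 1
  have b11 := b 1 1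
  have b12 := b 2 1
  have b13 := b 3 1
  have b14 := b 4 1
  have b15 := b 5 1
  have b16 := b 6 1
  have b17 := b 7 1
  have b18 := b 8 1
  have b19 := b 0 2
  have b20 := b 1 2
  have b21 := b 2 2
  have b22 := b 3 2
  have b23 := b 4 2
  norm_num at b1 b2 b3 b4 b5 b6 b7 b8 b9 b10 b11 b12 b13 b14 b15 b16 b17 b18 b19 b20 b21 b22 b23
  linarith [b1.1, b1.2, b2.1, b2.2, b3.1, b3.2, b4.1, b4.2, b5.1, b5.2, b6.1, b6.2, b7.1, b7.2, b8.1, b8.2, b9.1, b9.2, b10.1, b10.2, b11.1, b11.2, b12.1, b12.2, b13.1, b13.2, b14.1, b14.2, b15.1, b15.2, b16.1, b16.2, b17.1, b17.2, b18.1, b18.2, b19.1, b19.2, b20.1, b20.2, b21.1, b21.2, b22.1, b22.2, b23.1, b23.2, sq_nonneg u]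

theorem hyperbolic_coeff_two_nonneg (u y : ℝ) (hu : 0 ≤ u) (hu1 : u ≤ 9/20) (hy : 0 ≤ y) (hy1 : y ≤ 1/2) :
    0 ≤ (319/64 + 2063/64*u + 779/8*u^2 + 2647/16*u^3 + 9587/64*u^4 + 2659/64*u^5 - 1431/32*u^6 - 1449/32*u^7 - 243/16*u^8 - 27/16*u^9) + (27/8 + 45/2*u + 45*u^2 + 45/2*u^3 - 135/4*u^4 - 54*u^5 - 63/2*u^6 - 9*u^7 - 9/8*u^8)*y := by
  have b := sq_mul_pow_le u y hu hu1 hy hy1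
  have h1 : u^2 ≤ 9/20*u := by nlinarith
  have h2 : 0 ≤ u*y := mul_nonneg hu hy
  have h3 : u*y ≤ 1/2*u := by nlinarith
  have h4 : u*y^2 ≤ 1/4*u := by nlinarith [mul_nonneg hu (mul_nonneg hy (sub_nonneg.2 hy1))]
  have b1 := b 1 0
  have b2 := b 2 0
  have b3 := b 3 0
  have b4 := b 4 0
  have b5 := b 5 0
  have b6 := b 6 0
  have b7 := b 7 0
  have b8 := b 0 1
  have b9 := b 1 1
  have b10 := b 2 1
  have b11 := b 3 1
  have b12 := b 4 1
  have b13 := b 5 1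
  have b14 := b 6 1
  norm_num at b1 b2 b3 b4 b5 b6 b7 b8 b9 b10 b11 b12 b13 b14
  linarith [b1.1, b1.2, b2.1, b2.2, b3.1, b3.2, b4.1, b4.2, b5.1, b5.2, b6.1, b6.2, b7.1, b7.2, b8.1, b8.2, b9.1, b9.2, b10.1, b10.2, b11.1, b11.2, b12.1, b12.2, b13.1, b13.2, b14.1, b14.2, sq_nonneg u]

theorem hyperbolic_coeff_three_nonneg (u : ℝ) (hu : 0 ≤ u) :
    0 ≤ (9/2 + 81/2*u + 144*u^2 + 270*u^3 + 585/2*u^4 + 369/2*u^5 + 63*u^6 + 9*u^7) := by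
  positivity

/-- With `y ≤ κ u` the form is at least `u² (pc - qc κ - rc κ²)`, so a numerical check suffices on
each subinterval of `u`. -/
theorem hyperbolic_coeff_zero_aux (u y pc qc rc p q r κ : ℝ) (hu : 0 ≤ u) (hy : 0 ≤ y) (hp : pc ≤ p) (hq : -qc ≤ q)
    (hr : -rc ≤ r) (hyκ : y ≤ κ*u) (hqc : 0 ≤ qc) (hrc : 0 ≤ rc) (h : qc*κ + rc*κ^2 ≤ pc) :
    0 ≤ u^2*p + u*y*q + y^2*r := by
  have h1 : u*y ≤ κ*u^2 := by nlinarith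
  have h2 : y^2 ≤ κ^2*u^2 := by
    rw [← mul_pow]; exact pow_le_pow_left₀ hy hyκ 2
  have h3 := mul_le_mul_of_nonneg_left hp (sq_nonneg u)
  have h4 := mul_le_mul_of_nonneg_left hq (mul_nonneg hu hy)
  have h5 := mul_le_mul_of_nonneg_left hr (sq_nonneg y)
  have h6 := mul_le_mul_of_nonneg_left h1 hqc
  have h7 := mul_le_mul_of_nonneg_left h2 hrc
  have h8 := mul_le_mul_of_nonneg_left h (sq_nonneg u)
  linarith

-- This is the part of the defect at `e = 1/2`. It has no constant or linear term in `(u, y)`,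
-- because the two sides agree to first order over the Lagrange point; what remains is a quadratic
-- form with variable coefficients.
set_option maxHeartbeats 1000000 in
theorem hyperbolic_coeff_zero_nonneg (u y : ℝ) (hu : 0 ≤ u) (hu1 : u ≤ 9/20) (hy : 0 ≤ y)
    (hV : 2*(7/16*u + 11/32*u^2 - 1/8*u^3 - 1/32*u^4) + y ≤ 1/2) :
    0 ≤ u^2*(6671/16384 + 11309/8192*u + 33603/65536*u^2 - 179837/65536*u^3 - 141959/32768*u^4 - 72109/32768*u^5 + 26559/65536*u^6 + 46303/65536*u^7 + 981/8192*u^8 - 351/8192*u^9 - 117/8192*u^10 - 9/8192*u^11) + u*y*( - 7/1024 - 65/1024*u - 569/256*u^2 - 64005/8192*u^3 - 17805/2048*u^4 - 5317/2048*u^5 + 587/512*u^6 + 3485/4096*u^7 + 135/1024*u^8 - 9/256*u^9 - 27/2048*u^10 - 9/8192*u^11) + y^2*((63/256 + 153/256*u - 387/256*u^2 - 369/64*u^3 - 1305/256*u^4 - 171/128*u^5 + 99/256*u^6 + 9/32*u^7 + 9/256*u^8) + y*(-(9/32)*(1+u)^4)) := by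
  -- Cubic minorants of the three coefficients: powers above the third are absorbed through `u ≤
  -- 9/20`.
  have hp : 81/200 + 69/50*u + 51/100*u^2 - 257/50*u^3 ≤ 6671/16384 + 11309/8192*u + 33603/65536*u^2 - 179837/65536*u^3 - 141959/32768*u^4 - 72109/32768*u^5 + 26559/65536*u^6 + 46303/65536*u^7 + 981/8192*u^8 - 351/8192*u^9 - 117/8192*u^10 - 9/8192*u^11 := by
    have h4 : u^4 ≤ u^3*(9/20)^1 ∧ 0 ≤ u^4 := ⟨by
      rw [show u^4 = u^3*u^1 by ring]; gcongr, by positivity⟩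
    have h5 : u^5 ≤ u^3*(9/20)^2 ∧ 0 ≤ u^5 := ⟨by
      rw [show u^5 = u^3*u^2 by ring]; gcongr, by positivity⟩
    have h6 : u^6 ≤ u^3*(9/20)^3 ∧ 0 ≤ u^6 := ⟨by
      rw [show u^6 = u^3*u^3 by ring]; gcongr, by positivity⟩
    have h7 : u^7 ≤ u^3*(9/20)^4 ∧ 0 ≤ u^7 := ⟨by
      rw [show u^7 = u^3*u^4 by ring]; gcongr, by positivity⟩
    have h8 : u^8 ≤ u^3*(9/20)^5 ∧ 0 ≤ u^8 := ⟨by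
      rw [show u^8 = u^3*u^5 by ring]; gcongr, by positivity⟩
    have h9 : u^9 ≤ u^3*(9/20)^6 ∧ 0 ≤ u^9 := ⟨by
      rw [show u^9 = u^3*u^6 by ring]; gcongr, by positivity⟩
    have h10 : u^10 ≤ u^3*(9/20)^7 ∧ 0 ≤ u^10 := ⟨by
      rw [show u^10 = u^3*u^7 by ring]; gcongr, by positivity⟩
    have h11 : u^11 ≤ u^3*(9/20)^8 ∧ 0 ≤ u^11 := ⟨by
      rw [show u^11 = u^3*u^8 by ring]; gcongr, by positivity⟩
    have h3 : 0 ≤ u^3 := by positivity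
    have h2 : 0 ≤ u^2 := by positivity
    norm_num at h4 h5 h6 h7 h8 h9 h10 h11
    linarith [h4.1, h4.2, h5.1, h5.2, h6.1, h6.2, h7.1, h7.2, h8.1, h8.2, h9.1, h9.2, h10.1, h10.2, h11.1, h11.2]
  have hq :  - 1/100 - 13/200*u - 89/40*u^2 - 2451/200*u^3 ≤  - 7/1024 - 65/1024*u - 569/256*u^2 - 64005/8192*u^3 - 17805/2048*u^4 - 5317/2048*u^5 + 587/512*u^6 + 3485/4096*u^7 + 135/1024*u^8 - 9/256*u^9 - 27/2048*u^10 - 9/8192*u^11 := by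
    have h4 : u^4 ≤ u^3*(9/20)^1 ∧ 0 ≤ u^4 := ⟨by
      rw [show u^4 = u^3*u^1 by ring]; gcongr, by positivity⟩
    have h5 : u^5 ≤ u^3*(9/20)^2 ∧ 0 ≤ u^5 := ⟨by
      rw [show u^5 = u^3*u^2 by ring]; gcongr, by positivity⟩
    have h6 : u^6 ≤ u^3*(9/20)^3 ∧ 0 ≤ u^6 := ⟨by
      rw [show u^6 = u^3*u^3 by ring]; gcongr, by positivity⟩
    have h7 : u^7 ≤ u^3*(9/20)^4 ∧ 0 ≤ u^7 := ⟨by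
      rw [show u^7 = u^3*u^4 by ring]; gcongr, by positivity⟩
    have h8 : u^8 ≤ u^3*(9/20)^5 ∧ 0 ≤ u^8 := ⟨by
      rw [show u^8 = u^3*u^5 by ring]; gcongr, by positivity⟩
    have h9 : u^9 ≤ u^3*(9/20)^6 ∧ 0 ≤ u^9 := ⟨by
      rw [show u^9 = u^3*u^6 by ring]; gcongr, by positivity⟩
    have h10 : u^10 ≤ u^3*(9/20)^7 ∧ 0 ≤ u^10 := ⟨by
      rw [show u^10 = u^3*u^7 by ring]; gcongr, by positivity⟩
    have h11 : u^11 ≤ u^3*(9/20)^8 ∧ 0 ≤ u^11 := ⟨by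
      rw [show u^11 = u^3*u^8 by ring]; gcongr, by positivity⟩
    have h3 : 0 ≤ u^3 := by positivity
    have h2 : 0 ≤ u^2 := by positivity
    norm_num at h4 h5 h6 h7 h8 h9 h10 h11
    linarith [h4.1, h4.2, h5.1, h5.2, h6.1, h6.2, h7.1, h7.2, h8.1, h8.2, h9.1, h9.2, h10.1, h10.2, h11.1, h11.2]
  have hr : 49/200 + 119/200*u - 303/200*u^2 - 1667/200*u^3 ≤ 63/256 + 153/256*u - 387/256*u^2 - 369/64*u^3 - 1305/256*u^4 - 171/128*u^5 + 99/256*u^6 + 9/32*u^7 + 9/256*u^8 := by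
    have h4 : u^4 ≤ u^3*(9/20)^1 ∧ 0 ≤ u^4 := ⟨by
      rw [show u^4 = u^3*u^1 by ring]; gcongr, by positivity⟩
    have h5 : u^5 ≤ u^3*(9/20)^2 ∧ 0 ≤ u^5 := ⟨by
      rw [show u^5 = u^3*u^2 by ring]; gcongr, by positivity⟩
    have h6 : u^6 ≤ u^3*(9/20)^3 ∧ 0 ≤ u^6 := ⟨by
      rw [show u^6 = u^3*u^3 by ring]; gcongr, by positivity⟩
    have h7 : u^7 ≤ u^3*(9/20)^4 ∧ 0 ≤ u^7 := ⟨by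
      rw [show u^7 = u^3*u^4 by ring]; gcongr, by positivity⟩
    have h8 : u^8 ≤ u^3*(9/20)^5 ∧ 0 ≤ u^8 := ⟨by
      rw [show u^8 = u^3*u^5 by ring]; gcongr, by positivity⟩
    have h3 : 0 ≤ u^3 := by positivity
    have h2 : 0 ≤ u^2 := by positivity
    norm_num at h4 h5 h6 h7 h8
    linarith [h4.1, h4.2, h5.1, h5.2, h6.1, h6.2, h7.1, h7.2, h8.1, h8.2]
  set p := 6671/16384 + 11309/8192*u + 33603/65536*u^2 - 179837/65536*u^3 - 141959/32768*u^4 - 72109/32768*u^5 + 26559/65536*u^6 + 46303/65536*u^7 + 981/8192*u^8 - 351/8192*u^9 - 117/8192*u^10 - 9/8192*u^11 with dp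
  set q :=  - 7/1024 - 65/1024*u - 569/256*u^2 - 64005/8192*u^3 - 17805/2048*u^4 - 5317/2048*u^5 + 587/512*u^6 + 3485/4096*u^7 + 135/1024*u^8 - 9/256*u^9 - 27/2048*u^10 - 9/8192*u^11 with dq
  set r := 63/256 + 153/256*u - 387/256*u^2 - 369/64*u^3 - 1305/256*u^4 - 171/128*u^5 + 99/256*u^6 + 9/32*u^7 + 9/256*u^8 with dr
  clear_value p q r
  clear dp dq dr
  have hY : y ≤ 1/2 - 7/8*u - 1/2*u^2 := by
    have h3 : 0 ≤ u^2*(3/16-u/4-u^2/16) := mul_nonneg (sq_nonneg u) (by nlinarith)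
    linarith
  clear hV
  -- Near `u = 0` the ratio `y/u` is not bounded, so the form is compared with a positive definite
  -- one with constant coefficients.
  rcases le_total u (1/5) with h0 | h0
  · have l0 : 0 ≤ u^2 := by positivity
    have m2 : u^2 ≤ 1/5*u := by nlinarith
    have m3 : u^3 ≤ 1/25*u := by
      have := mul_le_mul_of_nonneg_left m2 hu
      linarith
    have m4 : (1+u)^4 ≤ 1+27/5*u := by
      have m4 : u^4 ≤ 1/125*u := by
        have := mul_le_mul_of_nonneg_left m3 hu
        linarith
      linarith
    have h4 : y*(1+u)^4 ≤ (1/2-7/8*u)*(1+27/5*u) := by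
      apply mul_le_mul (by linarith) m4 (by positivity) (by linarith)
    have hr2 : 9/200 ≤ r + y*(-(9/32)*(1+u)^4) := by linarith
    have hp2 : 9/25 ≤ p := by linarith
    have hq2 : -(11/50) ≤ q := by linarith
    have h7 := mul_le_mul_of_nonneg_left hp2 l0
    have h8 := mul_le_mul_of_nonneg_left hq2 (mul_nonneg hu hy)
    have h9 := mul_le_mul_of_nonneg_left hr2 (sq_nonneg y)
    nlinarith only [h7, h8, h9, sq_nonneg (u - 11/36*y), sq_nonneg y]
  -- From here on `κ` is the cap on `y` at the left end of the subinterval, divided by that end and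
  -- rounded up where necessary.
  rcases le_total u (6/25) with h1 | h1
  · have l2 : (1/5)^2 ≤ u^2 := by gcongr
    have l3 : (1/5)^3 ≤ u^3 := by gcongr
    have m2 : u^2 ≤ (6/25)^2 := by gcongr
    have m3 : u^3 ≤ (6/25)^3 := by gcongr
    have m4 : (1+u)^4 ≤ (1+6/25)^4 := by gcongr
    have hy2 : y ≤ 61/200 := by linarith
    have hm : y*(1+u)^4 ≤ 61/200*(1+6/25)^4 := by gcongr
    norm_num at l2 l3 m2 m3 hm
    exact hyperbolic_coeff_zero_aux u y (63/100) (81/250) (21/500) p q _ (61/40) hu hy (by linarith) (by linarith) (by linarith) (by linarith) (by norm_num) (by norm_num) (by norm_num)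
  rcases le_total u (27/100) with h2 | h2
  · have l2 : (6/25)^2 ≤ u^2 := by gcongr
    have l3 : (6/25)^3 ≤ u^3 := by gcongr
    have m2 : u^2 ≤ (27/100)^2 := by gcongr
    have m3 : u^3 ≤ (27/100)^3 := by gcongr
    have m4 : (1+u)^4 ≤ (1+27/100)^4 := by gcongr
    have hy2 : y ≤ 131/500 := by linarith
    have hm : y*(1+u)^4 ≤ 131/500*(1+27/100)^4 := by gcongr
    norm_num at l2 l3 m2 m3 hm
    exact hyperbolic_coeff_zero_aux u y (83/125) (431/1000) (79/1000) p q _ (273/250) hu hy (by linarith) (by linarith) (by linarith) (by linarith) (by norm_num) (by norm_num) (by norm_num)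
  rcases le_total u (31/100) with h3 | h3
  · have l2 : (27/100)^2 ≤ u^2 := by gcongr
    have l3 : (27/100)^3 ≤ u^3 := by gcongr
    have m2 : u^2 ≤ (31/100)^2 := by gcongr
    have m3 : u^3 ≤ (31/100)^3 := by gcongr
    have m4 : (1+u)^4 ≤ (1+31/100)^4 := by gcongr
    have hy2 : y ≤ 57/250 := by linarith
    have hm : y*(1+u)^4 ≤ 57/250*(1+31/100)^4 := by gcongr
    norm_num at l2 l3 m2 m3 hm
    exact hyperbolic_coeff_zero_aux u y (661/1000) (61/100) (89/500) p q _ (169/200) hu hy (by linarith) (by linarith) (by linarith) (by linarith) (by norm_num) (by norm_num) (by norm_num)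
  rcases le_total u (9/25) with h4 | h4
  · have l2 : (31/100)^2 ≤ u^2 := by gcongr
    have l3 : (31/100)^3 ≤ u^3 := by gcongr
    have m2 : u^2 ≤ (9/25)^2 := by gcongr
    have m3 : u^3 ≤ (9/25)^3 := by gcongr
    have m4 : (1+u)^4 ≤ (1+9/25)^4 := by gcongr
    have hy2 : y ≤ 181/1000 := by linarith
    have hm : y*(1+u)^4 ≤ 181/1000*(1+9/25)^4 := by gcongr
    norm_num at l2 l3 m2 m3 hm
    exact hyperbolic_coeff_zero_aux u y (641/1000) (447/500) (33/100) p q _ (73/125) hu hy (by linarith) (by linarith) (by linarith) (by linarith) (by norm_num) (by norm_num) (by norm_num)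
  rcases le_total u (21/50) with h5 | h5
  · have l2 : (9/25)^2 ≤ u^2 := by gcongr
    have l3 : (9/25)^3 ≤ u^3 := by gcongr
    have m2 : u^2 ≤ (21/50)^2 := by gcongr
    have m3 : u^3 ≤ (21/50)^3 := by gcongr
    have m4 : (1+u)^4 ≤ (1+21/50)^4 := by gcongr
    have hy2 : y ≤ 121/1000 := by linarith
    have hm : y*(1+u)^4 ≤ 121/1000*(1+21/50)^4 := by gcongr
    norm_num at l2 l3 m2 m3 hm
    exact hyperbolic_coeff_zero_aux u y (587/1000) (669/500) (141/250) p q _ (337/1000) hu hy (by linarith) (by linarith) (by linarith) (by linarith) (by norm_num) (by norm_num) (by norm_num)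
  have h6 := hu1
  have l2 : (21/50)^2 ≤ u^2 := by gcongr
  have l3 : (21/50)^3 ≤ u^3 := by gcongr
  have m2 : u^2 ≤ (9/20)^2 := by gcongr
  have m3 : u^3 ≤ (9/20)^3 := by gcongr
  have m4 : (1+u)^4 ≤ (1+9/20)^4 := by gcongr
  have hy2 : y ≤ 9/200 := by linarith
  have hm : y*(1+u)^4 ≤ 9/200*(1+9/20)^4 := by gcongr
  norm_num at l2 l3 m2 m3 hm
  exact hyperbolic_coeff_zero_aux u y (303/500) (1607/1000) (157/250) p q _ (27/250) hu hy (by linarith) (by linarith) (by linarith) (by linarith) (by norm_num) (by norm_num) (by norm_num)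
-- At `e = 1/2` the right side is `(16 V'')²`, and the left side bounds `256 X²` for the shear term
-- `X` of `hyperbolic_hessian_pos`.
theorem hyperbolic_discriminant_pos (C : ℝ) (h1 : 1 ≤ C) (h2 : C ≤ 11/6) :
    16*(C^2-1)*C^2*(C^4-17*C^2+16*C+16) < (-8*C^4+40*C^2-8*C-17)^2 := by
  obtain ⟨u, rfl⟩ : ∃ u, C = 1 + u := ⟨C - 1, by ring⟩
  have hu : 0 ≤ u := by linarith
  have hv : 0 ≤ 5 - 6*u := by linarith
  rw [← sub_pos]
  -- Bernstein form on `0 ≤ u ≤ 5/6`: all coefficients are positive.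
  have e : (-8*(1+u)^4+40*(1+u)^2-8*(1+u)-17)^2 - 16*((1+u)^2-1)*(1+u)^2*((1+u)^4-17*(1+u)^2+16*(1+u)+16)
      = (49/390625)*u^0*(5-6*u)^8 + (2592/390625)*u^1*(5-6*u)^7 + (75872/390625)*u^2*(5-6*u)^6 + (1284544/390625)*u^3*(5-6*u)^5 + (2391136/78125)*u^4*(5-6*u)^4 + (57431744/390625)*u^5*(5-6*u)^3 + (125759072/390625)*u^6*(5-6*u)^2 + (145435392/390625)*u^7*(5-6*u)^1 + (366754224/390625)*u^8*(5-6*u)^0 := by ring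
  rw [e]
  rcases hu.eq_or_lt with rfl | hu
  · norm_num
  · positivity

/-- Here `X` stands for `ζ sinh(2x₁)/2`, with `ζ² ≤ 2e - 2V`. The worst case is `d = 0`: raising `d`
raises `V''` and lowers the bound on `X²`. The energy bound `V ≤ e` already forces `C ≤ 11/6`. -/
theorem hyperbolic_hessian_pos (C d X : ℝ) (h1 : 1 ≤ C) (h2 : C ≤ 2) (hd : 0 ≤ d)
    (hX : X^2 ≤ (C^2-1)*C^2*(2*(1/2+d) - 2*((1/2+d)*C^2-C/2-C^2*(C^2-1)/32)))
    (hV : (1/2+d)*C^2-C/2-C^2*(C^2-1)/32 ≤ 1/2+d) :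
    0 < 2*(1/2+d)*(2*C^2-1)-C/2-(8*C^4-8*C^2+1)/16 + X := by
  have hC2 : 1 ≤ C^2 := one_le_pow₀ h1
  have h3 : C ≤ 11/6 := by
    by_contra hc
    push Not at hc
    have hC3 : (11/6)^2 ≤ C^2 := by gcongr
    have := mul_nonneg hd (sub_nonneg.2 hC2)
    nlinarith [mul_nonneg (sub_nonneg.2 h2) (sub_nonneg.2 hC3), mul_nonneg (sub_nonneg.2 h2) (sub_nonneg.2 h1)]
  have h4 := hyperbolic_discriminant_pos C h1 h3
  have h5 : 0 < -8*C^4+40*C^2-8*C-17 := by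
    obtain ⟨u, rfl⟩ : ∃ u, C = 1 + u := ⟨C - 1, by ring⟩
    have hu : 0 ≤ u := by linarith
    have hv : 0 ≤ 5 - 6*u := by linarith
    nlinarith [mul_nonneg hu hv, mul_nonneg (mul_nonneg hu hu) hv, mul_nonneg (mul_nonneg hu hu) (mul_nonneg hu hv)]
  have h6 : (16*X)^2 < (-8*C^4+40*C^2-8*C-17)^2 := by
    have : 0 ≤ (C^2-1)*C^2*(d*(C^2-1)) := by
      have := sub_nonneg.2 hC2
      positivity
    nlinarith
  have h7 := (abs_lt_of_sq_lt_sq' h6 h5.le).1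
  have := mul_nonneg hd (by linarith : 0 ≤ 2*C^2-1)
  nlinarith

/-- This is `V'² ≤ b (2V + (9/4) l²)` multiplied by `C`, with `b C` replaced by a lower bound free
of the sign of `ζ`. Under `l ≤ e/2` the difference of the sides is a cubic in `d` with nonnegative
coefficients. -/
theorem hyperbolic_defect_bound (C y d : ℝ) (h1 : 1 ≤ C) (h2 : C ≤ 2) (hy : 0 ≤ y) (hd : 0 ≤ d)
    (hV : (1/2+d)*C^2-C/2-C^2*(C^2-1)/32 + y/2 ≤ 1/4+d/2) :
    (C^2-1)*(2*(1/2+d)*C-1/2-C*(2*C^2-1)/16)^2*C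
      ≤ ((2*(1/2+d)*(2*C^2-1)-C/2-(8*C^4-8*C^2+1)/16)*C-(y*C^4+(C^2-1))/2)
        *(2*((1/2+d)*C^2-C/2-C^2*(C^2-1)/32)+9/4*((1/2+d)*C^2-C/2-C^2*(C^2-1)/32+y/2)^2) := by
  obtain ⟨u, rfl⟩ : ∃ u, C = 1 + u := ⟨C - 1, by ring⟩
  have hu : 0 ≤ u := by linarith
  have hu1 : u ≤ 1 := by linarith
  have hd2 := mul_nonneg hd (mul_nonneg hu (by linarith : 0 ≤ 2 + u))
  have hV' : 2*(7/16*u + 11/32*u^2 - 1/8*u^3 - 1/32*u^4) + y ≤ 1/2 := by linarith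
  -- The level cap with `y ≥ 0` first gives `u ≤ 1/2`, which sharpens the cubic and quartic terms
  -- enough for `9/20`.
  have hu2 : u ≤ 9/20 := by
    have e1 := mul_nonneg (mul_nonneg hu hu) (sub_nonneg.2 hu1)
    have e2 := mul_nonneg (mul_nonneg hu e1) hu
    have e3 := mul_nonneg (mul_nonneg hu e1) (sub_nonneg.2 hu1)
    have e4 := mul_nonneg hu e1
    have hu3 : u ≤ 1/2 := by nlinarith
    have e5 := mul_nonneg (mul_nonneg hu hu) (sub_nonneg.2 hu3)
    have e6 := mul_nonneg hu e5
    nlinarith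
  have hy1 : y ≤ 1/2 := by
    have : 0 ≤ u * (7/16 + 11/32*u - 1/8*u^2 - 1/32*u^3) := by
      apply mul_nonneg hu
      have e2 := mul_nonneg hu (sub_nonneg.2 hu1)
      have e3 := mul_nonneg hu e2
      linarith
    linarith
  have f0 := hyperbolic_coeff_zero_nonneg u y hu hu2 hy hV'
  have f1 := mul_nonneg hd (hyperbolic_coeff_one_nonneg u y hu hu2 hy hy1)
  have f2 := mul_nonneg (pow_nonneg hd 2) (hyperbolic_coeff_two_nonneg u y hu hu2 hy hy1)
  have f3 := mul_nonneg (pow_nonneg hd 3) (hyperbolic_coeff_three_nonneg u hu)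
  rw [← sub_nonneg]
  refine (add_nonneg (add_nonneg (add_nonneg f0 f1) f2) f3).trans_eq ?_
  ring

/-! ### Polynomial inequalities in the trigonometric variable -/

/-- With `k = cos² x₂` this says that `a ≤ 0` forces `l ≤ e/2`: for `W'' ≥ 0` the condition makes
`η²` large, and for `W'' < 0` the potential term is already small. -/
theorem trigonometric_level_bound (k e η : ℝ) (hk0 : 0 ≤ k) (hk1 : k ≤ 1) (he : 1/2 ≤ e)
    (X : ℝ) (hX : X^2 = η^2*(k*(1-k))) (ha : 2*e*(2*k-1)-(2*(2*k-1)^2-1)/16 ≤ X) :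
    k*e + k*(1-k)/32 - η^2/2 ≤ e/2 := by
  obtain ⟨x, rfl⟩ : ∃ x, k = (1+x)/2 := ⟨2*k-1, by ring⟩
  have hx0 : -1 ≤ x := by linarith
  have hx1 : x ≤ 1 := by linarith
  have hη := sq_nonneg η
  rcases le_total 0 (2*e*x - (2*x^2-1)/16) with hW | hW
  · have h1 : (2*e*x - (2*x^2-1)/16)^2 ≤ η^2*((1-x^2)/4) := by
      have : (2*e*x - (2*x^2-1)/16)^2 ≤ X^2 := by
        apply pow_le_pow_left₀ hW; linarith
      rw [hX] at this
      linarith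
    rcases hx1.eq_or_lt with rfl | hx1
    · nlinarith
    rcases hx0.eq_or_lt with rfl | hx0
    · nlinarith
    have h2 : 0 < 1 - x^2 := by nlinarith
    -- Here `x = cos 2x₂`, and the expression is exactly `2 W''² - (1 - x²)(e x/2 + (1 - x²)/128)`;
    -- the terms without a factor `x²` cancel.
    have h3 : 0 ≤ x^2*(8*e^2 - e*x/2 + (3*x^2-2)/128) := by
      apply mul_nonneg (sq_nonneg x)
      nlinarith [mul_nonneg (by linarith : 0 ≤ e) (by linarith : 0 ≤ 1 - x), sq_nonneg x]
    have h4 : (1-x^2)*(e*x/2 + (1-x^2)/128 - η^2/2) ≤ 0 := by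
      linarith
    have h5 : e*x/2 + (1-x^2)/128 - η^2/2 ≤ 0 := by
      by_contra hc
      push Not at hc
      linarith [mul_pos h2 hc]
    linarith
  · have h0 : e*x/2 + (1-x^2)/128 ≤ 0 := by
      rcases le_total (x^2) (1/3) with h | h
      · nlinarith
      · have : x ≤ -1/2 := by
          by_contra hc
          push Not at hc
          have hx : 0 < x := by
            by_contra hc2
            push Not at hc2
            nlinarith
          nlinarith
        nlinarith
    nlinarith

/-- The quotient by `k²` of the defect in `trigonometric_defect_pos`, with `h = k s`. The negative
contributions quadratic in `s` are collected in `-(9/2) s² m`, up to nonnegative remainders. -/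
theorem trigonometric_defect_aux (k s d : ℝ) (hk : 0 < k) (hk1 : k ≤ 1) (hd : 0 ≤ d) (hdh : d ≤ k*s)  (hs : s ≤ 1/2+d+(1-k)/32) (hs0 : 0 ≤ s) : 0 < 119/512+57/256*k-9/512*k^2 + s*(17/16-k/16)+s^2*(-153/64+423/128*k+9/128*k^2)+9/4*s^3*k+d*(3/2+3/8*k+2*s+s^2*(-9/2+27/4*k))+2*d^2 := by
  set t := 17/32+d-k/32 with ht
  set m := 17/32+d-k*(47/64+3/2*d) with hm
  clear_value t m
  have hst : s ≤ t := by linarith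
  have ht0 : 0 ≤ t := by linarith
  have e : 119/512+57/256*k-9/512*k^2 + s*(17/16-k/16)+s^2*(-153/64+423/128*k+9/128*k^2)+9/4*s^3*k+d*(3/2+3/8*k+2*s+s^2*(-9/2+27/4*k))+2*d^2 = (119/512+57/256*k-9/512*k^2+3/2*d+2*d^2) + (2*s*t-9/2*s^2*m) + (9/128*s^2*k^2 + 9/4*s^3*k + 3/8*d*k) := by
    rw [ht, hm]; ring
  rw [e]
  clear e
  have p1 : 0 ≤ 9/128*s^2*k^2 + 9/4*s^3*k + 3/8*d*k := by positivity
  have p0 : 0 < 119/512+57/256*k-9/512*k^2+3/2*d+2*d^2 := by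
    have h5 := mul_nonneg hk.le (sub_nonneg.2 hk1)
    have h6 := sq_nonneg d
    linarith
  -- At `m = 4/9` one has `(9/2) m = 2`. Below, `s ≤ t` gives `(9/2) s² m ≤ 2 s t`. Above, the
  -- excess over the value at `s = t` is `(9/2)(t - s)((m - 4/9) t + m s) ≥ 0`, so `s = t` is the
  -- worst case.
  by_cases hm0 : m ≤ 4/9
  · have : 9/2*s^2*m ≤ 2*s*t := by
      have h5 := mul_nonneg hs0 (sub_nonneg.2 hst)
      have h6 := mul_nonneg (mul_nonneg hs0 hs0) (sub_nonneg.2 hm0)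
      linarith
    linarith
  · push Not at hm0
    have h1 : 2*s*t-9/2*s^2*m ≥ t^2*(2-9/2*m) := by
      have h5 : 0 ≤ (m-4/9)*t + m*s :=
        add_nonneg (mul_nonneg (by linarith) ht0) (mul_nonneg (by linarith) hs0)
      have h6 := mul_nonneg (sub_nonneg.2 hst) h5
      linarith
    have hdk : d ≤ k * t := hdh.trans (mul_le_mul_of_nonneg_left hst hk.le)
    have hk3 : k ≤ 3/10 := by
      by_contra hc; push Not at hc
      have h3 : d*(1-k) ≤ 17/32*k := by
        have := mul_le_mul_of_nonneg_left (by linarith : t ≤ 17/32+d) hk.le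
        linarith
      have h4 : 0 < (17/32-4/9) - 47/64*k + d*(1-3/2*k) := by linarith
      by_cases h5 : k ≤ 2/3
      · clear h1 p0 p1
        have h6 := mul_le_mul_of_nonneg_right h3 (by linarith : 0 ≤ 1-3/2*k)
        have h7 := mul_nonneg h4.le (by linarith : 0 ≤ 1-k)
        have h8 : 0 < (k-3/10)*k := by apply mul_pos <;> linarith
        linarith
      · push Not at h5
        have := mul_nonneg hd (by linarith : 0 ≤ 3/2*k-1)
        linarith
    have hd2 : d ≤ 1/4 := by
      have := mul_le_mul_of_nonneg_right hk3 ht0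
      linarith
    have hm2 : m ≤ 17/32+d-47/64*k := by
      have := mul_nonneg hk.le hd
      rw [hm]; linarith
    have h2 : t^2*(2-9/2*m) ≥ t^2*(2-9/2*(17/32+d-47/64*k)) := by
      apply mul_le_mul_of_nonneg_left _ (sq_nonneg t); linarith
    have : 0 < 119/512+57/256*k-9/512*k^2+3/2*d+2*d^2 + t^2*(2-9/2*(17/32+d-47/64*k)) := by
      have hkd : 32/25*d ≤ k := by
        have : t ≤ 25/32 := by linarith
        have := mul_le_mul_of_nonneg_left this hk.le
        linarith
      have ht2 : t^2 ≤ 3/10+13/10*d := by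
        have : t ≤ 17/32+d := by linarith
        have h7 : t^2 ≤ (17/32+d)^2 := pow_le_pow_left₀ ht0 this 2
        have h8 := mul_le_mul_of_nonneg_left hd2 hd
        linarith
      have hu : -1/2 ≤ 2-9/2*(17/32+d-47/64*k) := by linarith
      have hkk : k^2 ≤ 1 := pow_le_one₀ hk.le hk1
      have := mul_le_mul_of_nonneg_left hu (sq_nonneg t)
      have := sq_nonneg d
      linarith
    linarith

/-- The first summand is `W'²`, and the last factor is a lower bound for `a`. The terms of first
order in `k` cancel after `h = k s`, leaving a factor `k²`; the hypothesis `d ≤ h` keeps `d` of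
order `k`. -/
theorem trigonometric_defect_pos (k h d : ℝ) (hk : 0 < k) (hk1 : k ≤ 1) (hd : 0 ≤ d) (hdh : d ≤ h)
    (hh : h ≤ k*(1/2+d)+k*(1-k)/32) :
    0 < 4*k*(1-k)*((1/2+d)-(2*k-1)/32)^2 + (2*(k*(1/2+d)+k*(1-k)/32) + 9/4*h^2) *
      (2*(1/2+d)*(2*k-1)-(2*(2*k-1)^2-1)/16 - (k*(1/2+d)+k*(1-k)/32) + h - k*(1-k)/2) := by
  obtain ⟨s, rfl⟩ : ∃ s, h = k*s := ⟨h/k, by field_simp⟩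
  have hs : s ≤ 1/2+d+(1-k)/32 := by
    refine le_of_mul_le_mul_left ?_ hk
    linarith
  have hs0 : 0 ≤ s := nonneg_of_mul_nonneg_right (hd.trans hdh) hk
  have := mul_pos (pow_pos hk 2) (trigonometric_defect_aux k s d hk hk1 hd hdh hs hs0)
  refine this.trans_eq ?_
  ring

/-! ### Separation of the regularized Hamiltonian for equal masses -/

/-- The trigonometric part of the regularized potential. -/
noncomputable def trigPotential (e x : ℝ) : ℝ := -(e * cos x ^ 2) - sin (2 * x) ^ 2 / 128

/-- The hyperbolic part of the regularized potential. -/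
noncomputable def hypPotential (e x : ℝ) : ℝ := e * cosh x ^ 2 - cosh x / 2 - sinh (2 * x) ^ 2 / 128

noncomputable def trigPotential' (e x : ℝ) : ℝ := e * sin (2 * x) - sin (4 * x) / 64
noncomputable def hypPotential' (e x : ℝ) : ℝ := e * sinh (2 * x) - sinh x / 2 - sinh (4 * x) / 64
noncomputable def trigPotential'' (e x : ℝ) : ℝ := 2 * e * cos (2 * x) - cos (4 * x) / 16
noncomputable def hypPotential'' (e x : ℝ) : ℝ :=
  2 * e * cosh (2 * x) - cosh x / 2 - cosh (4 * x) / 16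

/-- The two sheared momenta. -/
noncomputable def shearedMomentum₁ (z : E4) : ℝ := z 0 + sin (2 * z 3) / 8
noncomputable def shearedMomentum₂ (z : E4) : ℝ := z 1 + sinh (2 * z 2) / 8

theorem regHamiltonian_half (E : ℝ) (z : E4) :
    regHamiltonian (1 / 2) E z = (shearedMomentum₁ z ^ 2 + shearedMomentum₂ z ^ 2) / 2
      + hypPotential (-E / 4) (z 2) + trigPotential (-E / 4) (z 3) := by
  simp only [regHamiltonian, shearedMomentum₁, shearedMomentum₂, hypPotential, trigPotential]
  ring

theorem sin_four_mul (x : ℝ) : sin (4 * x) = 2 * sin (2 * x) * cos (2 * x) := by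
  rw [← sin_two_mul]; ring_nf

theorem cos_four_mul (x : ℝ) : cos (4 * x) = 2 * cos (2 * x) ^ 2 - 1 := by
  rw [← cos_two_mul]; ring_nf

theorem sinh_four_mul (x : ℝ) : sinh (4 * x) = 2 * sinh (2 * x) * cosh (2 * x) := by
  rw [← sinh_two_mul]; ring_nf

theorem cosh_two_mul' (x : ℝ) : cosh (2 * x) = 2 * cosh x ^ 2 - 1 := by
  have := cosh_sq x
  rw [cosh_two_mul]; linarith

theorem cosh_four_mul (x : ℝ) : cosh (4 * x) = 2 * cosh (2 * x) ^ 2 - 1 := by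
  rw [← cosh_two_mul']; ring_nf

theorem hasDerivAt_trigPotential (e x : ℝ) :
    HasDerivAt (trigPotential e) (trigPotential' e x) x := by
  have h2 : HasDerivAt (fun x : ℝ => 2 * x) 2 x := by simpa using (hasDerivAt_id x).const_mul 2
  have h := ((((hasDerivAt_id x).cos.pow 2).const_mul e).neg).sub ((h2.sin.pow 2).div_const 128)
  refine (h.congr_deriv ?_).congr_of_eventuallyEq (Filter.Eventually.of_forall fun w => by
    simp [trigPotential])
  simp only [trigPotential', sin_four_mul, sin_two_mul, id]
  push_cast
  ring

theorem hasDerivAt_hypPotential (e x : ℝ) :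
    HasDerivAt (hypPotential e) (hypPotential' e x) x := by
  have h2 : HasDerivAt (fun x : ℝ => 2 * x) 2 x := by simpa using (hasDerivAt_id x).const_mul 2
  have h := (((((hasDerivAt_id x).cosh.pow 2).const_mul e)).sub ((hasDerivAt_id x).cosh.div_const 2)).sub
    ((h2.sinh.pow 2).div_const 128)
  refine (h.congr_deriv ?_).congr_of_eventuallyEq (Filter.Eventually.of_forall fun w => by
    simp [hypPotential])
  simp only [hypPotential', sinh_four_mul, sinh_two_mul, id]
  push_cast
  ring

theorem hasDerivAt_trigPotential' (e x : ℝ) :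
    HasDerivAt (trigPotential' e) (trigPotential'' e x) x := by
  have h2 : HasDerivAt (fun x : ℝ => 2 * x) 2 x := by simpa using (hasDerivAt_id x).const_mul 2
  have h4 : HasDerivAt (fun x : ℝ => 4 * x) 4 x := by simpa using (hasDerivAt_id x).const_mul 4
  have h := (h2.sin.const_mul e).sub (h4.sin.div_const 64)
  refine (h.congr_deriv ?_).congr_of_eventuallyEq (Filter.Eventually.of_forall fun w => by
    simp [trigPotential'])
  simp only [trigPotential'']
  ring

theorem hasDerivAt_hypPotential' (e x : ℝ) :
    HasDerivAt (hypPotential' e) (hypPotential'' e x) x := by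
  have h2 : HasDerivAt (fun x : ℝ => 2 * x) 2 x := by simpa using (hasDerivAt_id x).const_mul 2
  have h4 : HasDerivAt (fun x : ℝ => 4 * x) 4 x := by simpa using (hasDerivAt_id x).const_mul 4
  have h := ((h2.sinh.const_mul e).sub ((hasDerivAt_id x).sinh.div_const 2)).sub
    (h4.sinh.div_const 64)
  refine (h.congr_deriv ?_).congr_of_eventuallyEq (Filter.Eventually.of_forall fun w => by
    simp [hypPotential'])
  simp only [hypPotential'', id]
  ring

/-! ### Gradient and Hessian in sheared coordinates -/

/-- The gradient of the regularized Hamiltonian for `μ = 1/2`, `E = -4 * e`. -/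
noncomputable def regGradient (e : ℝ) (z : E4) : E4 :=
  !₂[shearedMomentum₁ z, shearedMomentum₂ z,
    shearedMomentum₂ z * cosh (2 * z 2) / 4 + hypPotential' e (z 2),
    shearedMomentum₁ z * cos (2 * z 3) / 4 + trigPotential' e (z 3)]

/-- The Hessian of the regularized Hamiltonian for `μ = 1/2`, `E = -4 * e`. -/
noncomputable def regHessian (e : ℝ) (z : E4) : E4 →L[ℝ] E4 :=
  LinearMap.toContinuousLinearMap
    { toFun := fun v => !₂[v 0 + cos (2 * z 3) / 4 * v 3, v 1 + cosh (2 * z 2) / 4 * v 2,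
        cosh (2 * z 2) / 4 * v 1 + (cosh (2 * z 2) ^ 2 / 16 + shearedMomentum₂ z * sinh (2 * z 2) / 2
          + hypPotential'' e (z 2)) * v 2,
        cos (2 * z 3) / 4 * v 0 + (cos (2 * z 3) ^ 2 / 16 - shearedMomentum₁ z * sin (2 * z 3) / 2
          + trigPotential'' e (z 3)) * v 3]
      map_add' := fun u v => by ext i; fin_cases i <;> simp <;> ring
      map_smul' := fun c v => by ext i; fin_cases i <;> simp <;> ring }

theorem hasFDerivAt_coord (i : Fin 4) (z : E4) :
    HasFDerivAt (fun w : E4 => w i) (EuclideanSpace.proj i : E4 →L[ℝ] ℝ) z :=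
  (EuclideanSpace.proj i : E4 →L[ℝ] ℝ).hasFDerivAt

theorem hasFDerivAt_shearedMomentum₁ (z : E4) :
    HasFDerivAt shearedMomentum₁ ((EuclideanSpace.proj 0 : E4 →L[ℝ] ℝ)
      + (cos (2 * z 3) / 4) • (EuclideanSpace.proj 3 : E4 →L[ℝ] ℝ)) z := by
  have h := (hasFDerivAt_coord 0 z).add
    ((((hasFDerivAt_coord 3 z).const_mul 2).sin).mul_const (1/8))
  refine (h.congr_fderiv ?_).congr_of_eventuallyEq (Filter.Eventually.of_forall fun w => ?_)
  · ext v; simp; ring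
  · simp [shearedMomentum₁]; ring

theorem hasFDerivAt_shearedMomentum₂ (z : E4) :
    HasFDerivAt shearedMomentum₂ ((EuclideanSpace.proj 1 : E4 →L[ℝ] ℝ)
      + (cosh (2 * z 2) / 4) • (EuclideanSpace.proj 2 : E4 →L[ℝ] ℝ)) z := by
  have h := (hasFDerivAt_coord 1 z).add
    ((((hasFDerivAt_coord 2 z).const_mul 2).sinh).mul_const (1/8))
  refine (h.congr_fderiv ?_).congr_of_eventuallyEq (Filter.Eventually.of_forall fun w => ?_)
  · ext v; simp; ring
  · simp [shearedMomentum₂]; ring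

theorem hasGradientAt_regHamiltonian (E : ℝ) (z : E4) :
    HasGradientAt (regHamiltonian (1 / 2) E) (regGradient (-E / 4) z) z := by
  rw [hasGradientAt_iff_hasFDerivAt]
  have h1 := hasFDerivAt_shearedMomentum₁ z
  have h2 := hasFDerivAt_shearedMomentum₂ z
  have h := ((((h1.pow 2).add (h2.pow 2)).mul_const (1/2)).add
    ((hasDerivAt_hypPotential (-E/4) (z 2)).comp_hasFDerivAt z (hasFDerivAt_coord 2 z))).add
    ((hasDerivAt_trigPotential (-E/4) (z 3)).comp_hasFDerivAt z (hasFDerivAt_coord 3 z))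
  refine (h.congr_fderiv ?_).congr_of_eventuallyEq (Filter.Eventually.of_forall fun w => ?_)
  · ext v
    simp [regGradient, PiLp.inner_apply, Fin.sum_univ_four]
    ring
  · rw [regHamiltonian_half]
    simp only [Pi.add_apply, Function.comp]
    ring

theorem gradient_regHamiltonian (E : ℝ) :
    gradient (regHamiltonian (1 / 2) E) = regGradient (-E / 4) :=
  funext fun z => (hasGradientAt_regHamiltonian E z).gradient

theorem hasFDerivAt_regGradient (e : ℝ) (z : E4) :
    HasFDerivAt (regGradient e) (regHessian e z) z := by
  have h1 := hasFDerivAt_shearedMomentum₁ z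
  have h2 := hasFDerivAt_shearedMomentum₂ z
  rw [← hasFDerivWithinAt_univ, hasFDerivWithinAt_euclidean]
  intro i
  rw [hasFDerivWithinAt_univ]
  fin_cases i
  · refine (h1.congr_fderiv ?_)
    ext v; simp [regHessian]
  · refine (h2.congr_fderiv ?_)
    ext v; simp [regHessian]
  · have h := ((h2.mul ((hasFDerivAt_coord 2 z).const_mul 2).cosh).mul_const (1/4)).add
      ((hasDerivAt_hypPotential' e (z 2)).comp_hasFDerivAt z (hasFDerivAt_coord 2 z))
    refine (h.congr_fderiv ?_).congr_of_eventuallyEq (Filter.Eventually.of_forall fun w => ?_)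
    · ext v
      simp [regHessian]
      ring
    · simp [regGradient]
      ring
  · have h := ((h1.mul ((hasFDerivAt_coord 3 z).const_mul 2).cos).mul_const (1/4)).add
      ((hasDerivAt_trigPotential' e (z 3)).comp_hasFDerivAt z (hasFDerivAt_coord 3 z))
    refine (h.congr_fderiv ?_).congr_of_eventuallyEq (Filter.Eventually.of_forall fun w => ?_)
    · ext v
      simp [regHessian]
      ring
    · simp [regGradient]
      ring

/-- The part of the Hessian in the direction of `x₂` that is left after completing the square. -/
noncomputable def trigCurvature (e : ℝ) (z : E4) : ℝ :=
  trigPotential'' e (z 3) - shearedMomentum₁ z * sin (2 * z 3) / 2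

/-- The part of the Hessian in the direction of `x₁` that is left after completing the square. -/
noncomputable def hypCurvature (e : ℝ) (z : E4) : ℝ :=
  hypPotential'' e (z 2) + shearedMomentum₂ z * sinh (2 * z 2) / 2

/-- The two complete squares are the squares of the differentials of the sheared momenta; the
remainder is diagonal. -/
theorem inner_regHessian (e : ℝ) (z v : E4) :
    inner ℝ (regHessian e z v) v = (v 0 + cos (2 * z 3) / 4 * v 3) ^ 2
      + trigCurvature e z * v 3 ^ 2 + (v 1 + cosh (2 * z 2) / 4 * v 2) ^ 2
      + hypCurvature e z * v 2 ^ 2 := by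
  simp [regHessian, PiLp.inner_apply, Fin.sum_univ_four, trigCurvature, hypCurvature]
  ring

theorem inner_regGradient (e : ℝ) (z v : E4) :
    inner ℝ (regGradient e z) v = shearedMomentum₁ z * (v 0 + cos (2 * z 3) / 4 * v 3)
      + trigPotential' e (z 3) * v 3 + shearedMomentum₂ z * (v 1 + cosh (2 * z 2) / 4 * v 2)
      + hypPotential' e (z 2) * v 2 := by
  simp [regGradient, PiLp.inner_apply, Fin.sum_univ_four]
  ring

/-- A quadratic form `α² + a s² + β² + b t²` with at most one negative square is positive on the
kernel of a linear form which is long enough for the dual form. -/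
theorem quadratic_pos_of_mem_ker (a b p q r w α β s t : ℝ) (hb : 0 < b)
    (h : 0 < a ∨ 0 < p ^ 2 * b + a * ((q ^ 2 + r ^ 2) * b + w ^ 2))
    (hker : q * α + p * s + r * β + w * t = 0) (h0 : ¬ (α = 0 ∧ β = 0 ∧ s = 0 ∧ t = 0)) :
    0 < α ^ 2 + a * s ^ 2 + β ^ 2 + b * t ^ 2 := by
  have hT : 0 ≤ α ^ 2 + β ^ 2 + b * t ^ 2 := by positivity
  have hT0 : s = 0 → 0 < α ^ 2 + β ^ 2 + b * t ^ 2 := by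
    intro hs
    rcases hT.eq_or_lt with hT | hT
    · exfalso
      have h1 := sq_nonneg α
      have h2 := sq_nonneg β
      have h3 := mul_nonneg hb.le (sq_nonneg t)
      have h4 : b * t ^ 2 = 0 := by linarith
      exact h0 ⟨pow_eq_zero_iff two_ne_zero |>.1 (by linarith), pow_eq_zero_iff two_ne_zero |>.1
        (by linarith), hs, pow_eq_zero_iff two_ne_zero |>.1 ((mul_eq_zero.1 h4).resolve_left hb.ne')⟩
    · exact hT
  by_cases hs : s = 0
  · have := hT0 hs
    rw [hs]
    linarith
  have hs2 : 0 < s ^ 2 := by positivity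
  rcases lt_or_ge 0 a with ha | ha
  · have := mul_pos ha hs2
    linarith
  have h := h.resolve_left (not_lt.2 ha)
  have hK : 0 ≤ (q ^ 2 + r ^ 2) * b + w ^ 2 := by positivity
  -- The kernel relation gives `p s = -(q α + r β + w t)`; this is Cauchy-Schwarz for the weights
  -- `1, 1, b`, with denominators cleared.
  have hCS : p ^ 2 * s ^ 2 * b ≤ ((q ^ 2 + r ^ 2) * b + w ^ 2) * (α ^ 2 + β ^ 2 + b * t ^ 2) := by
    have e1 : p ^ 2 * s ^ 2 = (q * α + r * β + w * t) ^ 2 := by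
      rw [show q * α + r * β + w * t = -(p * s) by linarith]; ring
    rw [e1]
    nlinarith [mul_nonneg hb.le (sq_nonneg (q * β - r * α)), sq_nonneg (q * (b * t) - w * α),
      sq_nonneg (r * (b * t) - w * β)]
  have h2 := mul_pos h hs2
  have h3 : 0 < ((q ^ 2 + r ^ 2) * b + w ^ 2) * (α ^ 2 + β ^ 2 + b * t ^ 2 + a * s ^ 2) := by
    linarith
  have := pos_of_mul_pos_right h3 hK
  linarith

theorem trigPotential_eq (e x : ℝ) :
    trigPotential e x = -(cos x ^ 2 * e + cos x ^ 2 * (1 - cos x ^ 2) / 32) := by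
  have := sin_sq x
  rw [trigPotential, sin_two_mul, mul_pow, mul_pow, this]; ring

theorem hypPotential_eq (e x : ℝ) :
    hypPotential e x = e * cosh x ^ 2 - cosh x / 2 - cosh x ^ 2 * (cosh x ^ 2 - 1) / 32 := by
  have := sinh_sq x
  rw [hypPotential, sinh_two_mul, mul_pow, mul_pow, this]; ring

theorem trigPotential'_sq (e x : ℝ) : trigPotential' e x ^ 2 =
    4 * cos x ^ 2 * (1 - cos x ^ 2) * (e - (2 * cos x ^ 2 - 1) / 32) ^ 2 := by
  have := sin_sq x
  rw [trigPotential', sin_four_mul, cos_two_mul, sin_two_mul, ← this]; ring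

theorem hypPotential'_sq (e x : ℝ) : hypPotential' e x ^ 2 = (cosh x ^ 2 - 1) *
    (2 * e * cosh x - 1 / 2 - cosh x * (2 * cosh x ^ 2 - 1) / 16) ^ 2 := by
  have := sinh_sq x
  rw [hypPotential', sinh_four_mul, cosh_two_mul', sinh_two_mul, ← this]; ring

theorem trigPotential''_eq (e x : ℝ) : trigPotential'' e x =
    2 * e * (2 * cos x ^ 2 - 1) - (2 * (2 * cos x ^ 2 - 1) ^ 2 - 1) / 16 := by
  rw [trigPotential'', cos_four_mul, cos_two_mul]

theorem hypPotential''_eq (e x : ℝ) : hypPotential'' e x =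
    2 * e * (2 * cosh x ^ 2 - 1) - cosh x / 2 - (8 * cosh x ^ 4 - 8 * cosh x ^ 2 + 1) / 16 := by
  rw [hypPotential'', cosh_four_mul, cosh_two_mul']; ring

theorem trigPotential_ge (e x : ℝ) (he : 1 / 2 ≤ e) : -e ≤ trigPotential e x := by
  rw [trigPotential_eq]
  have h1 : cos x ^ 2 ≤ 1 := cos_sq_le_one x
  have h2 : 0 ≤ cos x ^ 2 := sq_nonneg _
  nlinarith

/-! ### Positivity of the Hessian on tangent spaces -/

section ZeroLevel

variable {e : ℝ} {z : E4}

theorem hypCurvature_pos (he : 1 / 2 ≤ e) (hc : cosh (z 2) ≤ 2)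
    (h : (shearedMomentum₁ z ^ 2 + shearedMomentum₂ z ^ 2) / 2 + hypPotential e (z 2)
      + trigPotential e (z 3) ≤ 0) : 0 < hypCurvature e z := by
  have h1 := trigPotential_ge e (z 3) he
  have h2 := sq_nonneg (shearedMomentum₁ z)
  have h3 := sq_nonneg (shearedMomentum₂ z)
  rw [hypCurvature, hypPotential''_eq]
  have e1 : 1 / 2 + (e - 1 / 2) = e := by ring
  have := hyperbolic_hessian_pos (cosh (z 2)) (e - 1 / 2) (shearedMomentum₂ z * sinh (2 * z 2) / 2)
    (one_le_cosh _) hc (by linarith)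
  simp only [e1, ← hypPotential_eq] at this
  refine this ?_ (by linarith)
  have hs := sinh_sq (z 2)
  rw [sinh_two_mul, ← hs]
  have : shearedMomentum₂ z ^ 2 ≤ 2 * e - 2 * hypPotential e (z 2) := by linarith
  have h5 : 0 ≤ sinh (z 2) ^ 2 * cosh (z 2) ^ 2 := by positivity
  have := mul_le_mul_of_nonneg_left this h5
  linarith

-- The level `l` joins two otherwise separate estimates: `e - 1/2 ≤ V ≤ l`, and `a ≤ 0` gives `l ≤
-- e/2`, so both defect inequalities apply.
set_option maxHeartbeats 1000000 in
theorem trigCurvature_pos_or (he : 1 / 2 ≤ e) (hc : cosh (z 2) ≤ 2) (hk : cos (z 3) ≠ 0)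
    (h : (shearedMomentum₁ z ^ 2 + shearedMomentum₂ z ^ 2) / 2 + hypPotential e (z 2)
      + trigPotential e (z 3) = 0) :
    0 < trigCurvature e z ∨ 0 < trigPotential' e (z 3) ^ 2 * hypCurvature e z + trigCurvature e z *
      ((shearedMomentum₁ z ^ 2 + shearedMomentum₂ z ^ 2) * hypCurvature e z
        + hypPotential' e (z 2) ^ 2) := by
  rw [or_iff_not_imp_left]
  intro ha
  push Not at ha
  have hb := hypCurvature_pos he hc h.le
  set k := cos (z 3) ^ 2 with hkdef
  set C := cosh (z 2) with hCdef
  set η := shearedMomentum₁ z with hη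
  set ζ := shearedMomentum₂ z with hζ
  have hk0 : 0 < k := by positivity
  have hk1 : k ≤ 1 := cos_sq_le_one _
  have hC1 : 1 ≤ C := one_le_cosh _
  have hs := sin_sq (z 3)
  have hS := sinh_sq (z 2)
  rw [← hkdef] at hs
  rw [← hCdef] at hS
  have e1 : 1 / 2 + (e - 1 / 2) = e := by ring
  set l := hypPotential e (z 2) + ζ ^ 2 / 2 with hl
  have hl' : l = k * e + k * (1 - k) / 32 - η ^ 2 / 2 := by
    rw [trigPotential_eq] at h
    linarith
  have hV : e - 1 / 2 ≤ hypPotential e (z 2) := by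
    rw [hypPotential_eq, ← hCdef]
    have h2 : 0 ≤ (C - 1) * ((e - 1 / 2) * (C + 1) + C / 2 - C ^ 2 * (C + 1) / 32) := by
      apply mul_nonneg (by linarith)
      have := mul_nonneg (sub_nonneg.2 he) (by linarith : 0 ≤ C + 1)
      have h3 : 0 ≤ C * (2 - C) := mul_nonneg (by linarith) (by linarith)
      have h4 := mul_nonneg (by linarith : 0 ≤ C) h3
      linarith
    linarith
  have hlow : e - 1 / 2 ≤ l := by
    have := sq_nonneg ζ
    linarith
  have hlevel : l ≤ e / 2 := by
    rw [hl']
    refine trigonometric_level_bound k e η hk0.le hk1 he (η * sin (2 * z 3) / 2) ?_ ?_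
    · rw [sin_two_mul, ← hs, hkdef]; ring
    · rw [trigCurvature, trigPotential''_eq] at ha
      linarith
  have hdef := hyperbolic_defect_bound C (ζ ^ 2) (e - 1 / 2) hC1 hc (sq_nonneg _) (by linarith)
  simp only [e1] at hdef
  rw [← hypPotential_eq, ← hl] at hdef
  have hdef := hdef (by linarith)
  have hl0 : 0 ≤ 2 * hypPotential e (z 2) + 9 / 4 * l ^ 2 := by
    have := sq_nonneg l
    linarith
  -- The mixed term `ζ sinh x₁ cosh² x₁` is bounded below by completing the square of `ζ cosh² x₁ +
  -- sinh x₁`.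
  have hbC : (hypPotential'' e (z 2) * C - (ζ ^ 2 * C ^ 4 + (C ^ 2 - 1)) / 2)
      ≤ hypCurvature e z * C := by
    rw [hypCurvature, sinh_two_mul, ← hS, ← hCdef, ← hζ]
    have h12 := sq_nonneg (ζ * C ^ 2 + sinh (z 2))
    rw [add_sq, mul_pow] at h12
    linarith only [h12]
  have hV' : hypPotential' e (z 2) ^ 2 ≤ hypCurvature e z * (2 * hypPotential e (z 2) + 9 / 4 * l ^ 2) := by
    rw [hypPotential''_eq, ← hCdef] at hbC
    have h6 := hdef.trans (mul_le_mul_of_nonneg_right hbC hl0)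
    rw [← hypPotential'_sq] at h6
    refine le_of_mul_le_mul_right ?_ (by linarith : 0 < C)
    linarith
  have htrig := trigonometric_defect_pos k l (e - 1 / 2) hk0 hk1 (by linarith) hlow (by
    rw [hl', e1]
    have := sq_nonneg η
    linarith)
  rw [e1, ← trigPotential'_sq, ← trigPotential''_eq] at htrig
  -- Completing the square of `η - sin x₂ cos x₂` bounds the mixed term; then `η²/2` is expressed
  -- through `l`.
  have ha2 : trigPotential'' e (z 3) - (k * e + k * (1 - k) / 32) + l - k * (1 - k) / 2
      ≤ trigCurvature e z := by
    rw [trigCurvature, sin_two_mul, hl', ← hη]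
    have : (sin (z 3) * cos (z 3)) ^ 2 = k * (1 - k) := by rw [← hs, hkdef]; ring
    have h12 := sq_nonneg (η - sin (z 3) * cos (z 3))
    rw [sub_sq, this] at h12
    linarith only [h12]
  have hω : 0 ≤ 2 * (k * e + k * (1 - k) / 32) + 9 / 4 * l ^ 2 := by
    have := mul_nonneg hk0.le (sub_nonneg.2 hk1)
    have := mul_nonneg hk0.le (by linarith : 0 ≤ e)
    have := sq_nonneg l
    linarith
  have h7 := mul_le_mul_of_nonneg_left ha2 hω
  have h8 := mul_le_mul_of_nonpos_left hV' ha
  have h9 : 0 < trigPotential' e (z 3) ^ 2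
      + (2 * (k * e + k * (1 - k) / 32) + 9 / 4 * l ^ 2) * trigCurvature e z := by linarith
  have h10 := mul_pos h9 hb
  -- The zero level turns `-2W` into `η² + ζ² + 2V`, which cancels the `2V` of the hyperbolic bound.
  have h11 : k * e + k * (1 - k) / 32 = (η ^ 2 + ζ ^ 2) / 2 + hypPotential e (z 2) := by linarith
  rw [h11] at h10
  refine h10.trans_le ?_
  linarith

/-- The Hessian of the regularized Hamiltonian is positive definite on the tangent spaces of the
bounded part of the zero level, away from the equilibria. -/
theorem regHessian_pos (he : 1 / 2 ≤ e) (hc : cosh (z 2) ≤ 2) (hk : cos (z 3) ≠ 0)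
    (h : (shearedMomentum₁ z ^ 2 + shearedMomentum₂ z ^ 2) / 2 + hypPotential e (z 2)
      + trigPotential e (z 3) = 0) {v : E4} (hv : v ≠ 0)
    (hker : inner ℝ (regGradient e z) v = 0) : 0 < inner ℝ (regHessian e z v) v := by
  rw [inner_regGradient] at hker
  rw [inner_regHessian]
  refine quadratic_pos_of_mem_ker _ _ _ _ _ _ _ _ _ _ (hypCurvature_pos he hc h.le)
    (trigCurvature_pos_or he hc hk h) hker ?_
  rintro ⟨h0, h1, h3, h2⟩
  rw [h3] at h0
  rw [h2] at h1
  apply hv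
  ext i
  fin_cases i
  · simpa using h0
  · simpa using h1
  · simpa using h2
  · simpa using h3

end ZeroLevel

/-! ### Gauss equation and sectional curvature of level sets -/

section LevelSets

variable {G : E4 → ℝ} {z : E4}

theorem tangentialPart_add (w u v : E4) :
    tangentialPart G w (u + v) = tangentialPart G w u + tangentialPart G w v := by
  simp only [tangentialPart, inner_add_right, add_smul]; abel

theorem tangentialPart_sub (w u v : E4) :
    tangentialPart G w (u - v) = tangentialPart G w u - tangentialPart G w v := by
  simp only [tangentialPart, inner_sub_right, sub_smul]; abel

theorem tangentialPart_smul (w : E4) (c : ℝ) (v : E4) :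
    tangentialPart G w (c • v) = c • tangentialPart G w v := by
  simp only [tangentialPart, inner_smul_right, smul_sub, smul_smul]

theorem tangentialPart_of_inner_eq_zero {w v : E4} (h : inner ℝ (unitNormal G w) v = 0) :
    tangentialPart G w v = v := by
  simp [tangentialPart, h]

theorem norm_unitNormal {w : E4} (h : gradient G w ≠ 0) : ‖unitNormal G w‖ = 1 := by
  rw [unitNormal, norm_smul, norm_inv, norm_norm, inv_mul_cancel₀ (norm_ne_zero_iff.2 h)]

theorem inner_unitNormal_self {w : E4} (h : gradient G w ≠ 0) :
    inner ℝ (unitNormal G w) (unitNormal G w) = (1 : ℝ) := by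
  rw [real_inner_self_eq_norm_sq, norm_unitNormal h, one_pow]

theorem tangentialPart_unitNormal {w : E4} (h : gradient G w ≠ 0) :
    tangentialPart G w (unitNormal G w) = 0 := by
  simp [tangentialPart, norm_unitNormal h]

/-- The derivative of the tangential part of a vector field. -/
theorem fderiv_tangentialPart {q : E4 → E4} (hN : DifferentiableAt ℝ (unitNormal G) z)
    (hq : DifferentiableAt ℝ q z) (x : E4) :
    fderiv ℝ (fun w => tangentialPart G w (q w)) z x = fderiv ℝ q z x
      - (inner ℝ (unitNormal G z) (fderiv ℝ q z x)
          + inner ℝ (fderiv ℝ (unitNormal G) z x) (q z)) • unitNormal G z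
      - inner ℝ (unitNormal G z) (q z) • fderiv ℝ (unitNormal G) z x := by
  have h := hq.hasFDerivAt.sub ((hN.hasFDerivAt.inner ℝ hq.hasFDerivAt).smul hN.hasFDerivAt)
  have e : (fun w => tangentialPart G w (q w))
      = q - (fun w => inner ℝ (unitNormal G w) (q w)) • unitNormal G := rfl
  rw [e, h.fderiv]
  simp [fderivInnerCLM_apply]
  abel

theorem contDiffAt_unitNormal (hG : ContDiffAt ℝ 2 (gradient G) z) (h0 : gradient G z ≠ 0) :
    ContDiffAt ℝ 2 (unitNormal G) z :=
  ((hG.norm ℝ h0).inv (norm_ne_zero_iff.2 h0)).smul hG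

theorem inner_fderiv_unitNormal (hG : ContDiffAt ℝ 2 (gradient G) z) (h0 : gradient G z ≠ 0)
    (x : E4) : inner ℝ (fderiv ℝ (unitNormal G) z x) (unitNormal G z) = 0 := by
  have hN := (contDiffAt_unitNormal hG h0).differentiableAt two_ne_zero
  have h1 := (hN.hasFDerivAt.inner ℝ hN.hasFDerivAt)
  have h2 : HasFDerivAt (fun w => inner ℝ (unitNormal G w) (unitNormal G w)) (0 : E4 →L[ℝ] ℝ) z := by
    refine (hasFDerivAt_const (1 : ℝ) z).congr_of_eventuallyEq ?_
    filter_upwards [hG.continuousAt.eventually_ne h0] with w hw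
    exact inner_unitNormal_self hw
  have h3 := DFunLike.congr_fun (h1.unique h2) x
  simp [fderivInnerCLM_apply] at h3
  rw [real_inner_comm] at h3
  linarith [real_inner_comm (unitNormal G z) (fderiv ℝ (unitNormal G) z x)]

/-- The second fundamental form. -/
theorem inner_fderiv_unitNormal_of_tangent (hG : ContDiffAt ℝ 2 (gradient G) z)
    (h0 : gradient G z ≠ 0) (u v : E4) (hv : inner ℝ (gradient G z) v = 0) :
    inner ℝ (fderiv ℝ (unitNormal G) z u) v
      = ‖gradient G z‖⁻¹ * inner ℝ (fderiv ℝ (gradient G) z u) v := by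
  have h1 := ((hG.norm ℝ h0).inv (norm_ne_zero_iff.2 h0)).differentiableAt two_ne_zero
  have h2 := (hG.differentiableAt two_ne_zero)
  have e : unitNormal G = (fun w => ‖gradient G w‖⁻¹) • gradient G := rfl
  have h := h1.hasFDerivAt.smul h2.hasFDerivAt
  have h' : fderiv ℝ (unitNormal G) z u = _ := DFunLike.congr_fun h.fderiv u
  rw [h']
  simp [inner_add_left, inner_smul_left, hv]

/-- The Gauss equation for the level sets of a function. -/
theorem riemannCurvature_eq (hG : ContDiffAt ℝ 2 (gradient G) z) (h0 : gradient G z ≠ 0)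
    {X Y Z : E4 → E4} (hX : ContDiffAt ℝ 2 X z) (hY : ContDiffAt ℝ 2 Y z)
    (hZ : ContDiffAt ℝ 2 Z z) :
    riemannCurvature G X Y Z z
      = inner ℝ (unitNormal G z) (fderiv ℝ Z z (X z)) • fderiv ℝ (unitNormal G) z (Y z)
        - inner ℝ (unitNormal G z) (fderiv ℝ Z z (Y z)) • fderiv ℝ (unitNormal G) z (X z) := by
  have hN := (contDiffAt_unitNormal hG h0).differentiableAt two_ne_zero
  have hZ1 : DifferentiableAt ℝ (fderiv ℝ Z) z :=
    (hZ.fderiv_right (m := 1) (by norm_num)).differentiableAt one_ne_zero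
  -- Differentiating the inner projection adds a normal vector, which the outer projection kills,
  -- and a shape operator term. In the commutator the second derivatives of `Z` cancel and the first
  -- derivatives cancel against the bracket.
  have key : ∀ {A B : E4 → E4}, ContDiffAt ℝ 2 B z →
      leviCivita G A (leviCivita G B Z) z = tangentialPart G z (fderiv ℝ (fderiv ℝ Z) z (A z) (B z)
        + fderiv ℝ Z z (fderiv ℝ B z (A z)))
        - inner ℝ (unitNormal G z) (fderiv ℝ Z z (B z)) • fderiv ℝ (unitNormal G) z (A z) := by
    intro A B hB
    have hB1 := hB.differentiableAt two_ne_zero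
    have hq := hZ1.hasFDerivAt.clm_apply hB1.hasFDerivAt
    have e : leviCivita G B Z = fun w => tangentialPart G w (fderiv ℝ Z w (B w)) := rfl
    rw [leviCivita, e, fderiv_tangentialPart hN hq.differentiableAt, hq.fderiv,
      tangentialPart_sub, tangentialPart_sub, tangentialPart_smul, tangentialPart_smul,
      tangentialPart_unitNormal h0, tangentialPart_of_inner_eq_zero
        (v := fderiv ℝ (unitNormal G) z (A z)) (by
          rw [real_inner_comm]; exact inner_fderiv_unitNormal hG h0 _)]
    simp only [smul_zero, sub_zero]
    simp [add_comm]
  have hsymm : fderiv ℝ (fderiv ℝ Z) z (X z) (Y z) = fderiv ℝ (fderiv ℝ Z) z (Y z) (X z) :=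
    (hZ.isSymmSndFDerivAt (by simp)) (X z) (Y z)
  rw [riemannCurvature, key hY, key hX, leviCivita, VectorField.lieBracket, map_sub,
    tangentialPart_sub, tangentialPart_add, tangentialPart_add, hsymm]
  abel

theorem sectionalCurvature_eq (hG : ContDiffAt ℝ 2 (gradient G) z) (h0 : gradient G z ≠ 0)
    {u v : E4} (hu : inner ℝ (gradient G z) u = 0) (hv : inner ℝ (gradient G z) v = 0) :
    sectionalCurvature G z u v = (‖gradient G z‖⁻¹) ^ 2 *
      (inner ℝ (fderiv ℝ (gradient G) z u) u * inner ℝ (fderiv ℝ (gradient G) z v) v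
        - inner ℝ (fderiv ℝ (gradient G) z u) v * inner ℝ (fderiv ℝ (gradient G) z v) u)
      / (‖u‖ ^ 2 * ‖v‖ ^ 2 - inner ℝ u v ^ 2) := by
  have hN := contDiffAt_unitNormal hG h0
  have hN1 := hN.differentiableAt two_ne_zero
  have hT : ∀ w : E4, ContDiffAt ℝ 2 (fun x => tangentialPart G x w) z := fun w =>
    contDiffAt_const.sub ((hN.inner ℝ contDiffAt_const).smul hN)
  have hnormal : ∀ {w : E4}, inner ℝ (gradient G z) w = 0 → inner ℝ (unitNormal G z) w = 0 := by
    intro w hw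
    rw [unitNormal, real_inner_smul_left, hw, mul_zero]
  have hval : ∀ {w : E4}, inner ℝ (gradient G z) w = 0 → tangentialPart G z w = w := fun hw =>
    tangentialPart_of_inner_eq_zero (hnormal hw)
  have hd : ∀ x : E4, inner ℝ (unitNormal G z) (fderiv ℝ (fun w => tangentialPart G w v) z x)
      = -inner ℝ (fderiv ℝ (unitNormal G) z x) v := by
    intro x
    rw [fderiv_tangentialPart hN1 (differentiableAt_const v)]
    simp [inner_smul_right, norm_unitNormal h0, hnormal hv]
  rw [sectionalCurvature, riemannCurvature_eq hG h0 (hT u) (hT v) (hT v)]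
  congr 1
  simp only [hval hu, hval hv]
  rw [hd, hd, inner_sub_left, inner_smul_left, inner_smul_left]
  simp only [inner_fderiv_unitNormal_of_tangent hG h0 _ _ hu,
    inner_fderiv_unitNormal_of_tangent hG h0 _ _ hv, conj_trivial]
  ring

/-- A level set is positively curved where the Hessian is positive definite on the tangent space. -/
theorem hasPositiveCurvatureAt_of_hessian_pos (hG : ContDiffAt ℝ 2 (gradient G) z)
    (h0 : gradient G z ≠ 0)
    (hsymm : ∀ u v, inner ℝ (fderiv ℝ (gradient G) z u) v = inner ℝ (fderiv ℝ (gradient G) z v) u)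
    (hpos : ∀ v, v ≠ 0 → inner ℝ (gradient G z) v = 0 →
      0 < inner ℝ (fderiv ℝ (gradient G) z v) v) : HasPositiveCurvatureAt G z := by
  refine ⟨h0, fun u v hu hv hli => ?_⟩
  have hli' := LinearIndependent.pair_iff.1 hli
  have hu0 : u ≠ 0 := hli.ne_zero 0
  have hv0 : v ≠ 0 := hli.ne_zero 1
  rw [sectionalCurvature_eq hG h0 hu hv]
  apply div_pos
  · apply mul_pos (by positivity)
    set A := fderiv ℝ (gradient G) z with hA
    -- The Hessian form of this tangent vector is `⟨A u, u⟩` times the two-by-two determinant in the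
    -- curvature formula.
    have hw0 : inner ℝ (A u) u • v - inner ℝ (A u) v • u ≠ 0 := by
      intro h
      have := hli' (-inner ℝ (A u) v) (inner ℝ (A u) u) (by rw [← h, neg_smul]; abel)
      exact (hpos u hu0 hu).ne' this.2
    have h1 := hpos _ hw0 (by simp [inner_sub_right, inner_smul_right, hu, hv])
    have hp := hpos u hu0 hu
    simp only [map_sub, map_smul, inner_sub_left, inner_sub_right, inner_smul_left,
      inner_smul_right, conj_trivial] at h1
    rw [hsymm v u] at h1 ⊢
    have h2 : 0 < inner ℝ (A u) u * (inner ℝ (A u) u * inner ℝ (A v) v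
        - inner ℝ (A u) v * inner ℝ (A u) v) := by
      linarith
    exact pos_of_mul_pos_right h2 hp.le
  · have h1 : |inner ℝ u v| < ‖u‖ * ‖v‖ := by
      refine lt_of_le_of_ne (abs_real_inner_le_norm u v) fun h => ?_
      have h3 := (norm_inner_eq_norm_iff (𝕜 := ℝ) hu0 hv0).1 h
      obtain ⟨r, -, hr⟩ := h3
      have := hli' r (-1) (by rw [hr]; simp)
      norm_num at this
    have h2 : |inner ℝ u v| ^ 2 < (‖u‖ * ‖v‖) ^ 2 := pow_lt_pow_left₀ h1 (abs_nonneg _) two_ne_zero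
    rw [sq_abs] at h2
    linarith

end LevelSets

/-! ### From local to global convexity -/

theorem isOpen_setOf_lineMap_mem {U : Set E4} (hU : IsOpen U) (p : E4) :
    IsOpen {q : E4 | ∀ s ∈ Icc (0 : ℝ) 1, AffineMap.lineMap p q s ∈ U} := by
  rw [isOpen_iff_mem_nhds]
  intro q hq
  refine isCompact_Icc.eventually_forall_of_forall_eventually fun s hs => ?_
  have hc : Continuous fun x : E4 × ℝ => (AffineMap.lineMap p x.1 x.2 : E4) := by
    simp only [AffineMap.lineMap_apply]
    fun_prop
  exact hc.continuousAt.preimage_mem_nhds (hU.mem_nhds (hq s hs))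

/-- A connected open set is convex if the Hessian of a defining function is positive on the tangent
spaces of the boundary, at all boundary points inside segments between points of the set. -/
theorem convex_of_hessian_pos {U : Set E4} (hU : IsOpen U) (hc : IsPreconnected U) {f : E4 → ℝ}
    {g : E4 → E4} {A : E4 → E4 →L[ℝ] E4} (hg : ∀ z, HasGradientAt f (g z) z)
    (hA : ∀ z, HasFDerivAt g (A z) z) (hle : ∀ z ∈ closure U, f z ≤ 0)
    (hpos : ∀ p ∈ U, ∀ q ∈ U, ∀ s ∈ Ioo (0 : ℝ) 1, AffineMap.lineMap p q s ∈ closure U →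
      AffineMap.lineMap p q s ∉ U → f (AffineMap.lineMap p q s) = 0 ∧ ∀ v, v ≠ 0 →
        inner ℝ (g (AffineMap.lineMap p q s)) v = 0 →
        0 < inner ℝ (A (AffineMap.lineMap p q s) v) v) : Convex ℝ U := by
  rw [convex_iff_segment_subset]
  intro p hp q hq
  -- The points visible from `p` form an open set; by connectedness it suffices that it is closed
  -- relative to `U`.
  set T := {q : E4 | ∀ s ∈ Icc (0 : ℝ) 1, AffineMap.lineMap p q s ∈ U} with hT
  suffices h : U ⊆ T by
    rw [segment_eq_image_lineMap]
    rintro _ ⟨s, hs, rfl⟩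
    exact h hq s hs
  refine hc.subset_of_closure_inter_subset (isOpen_setOf_lineMap_mem hU p)
    ⟨p, hp, fun s _ => by simpa using hp⟩ ?_
  rintro q ⟨hqT, hq⟩
  have hcl : ∀ s ∈ Icc (0 : ℝ) 1, AffineMap.lineMap p q s ∈ closure U := by
    intro s hs
    have hcont : Continuous fun x : E4 => (AffineMap.lineMap p x s : E4) := by
      simp only [AffineMap.lineMap_apply]
      fun_prop
    exact map_mem_closure (f := fun x : E4 => (AffineMap.lineMap p x s : E4)) hcont hqT
      fun x hx => hx s hs
  intro s hs
  by_contra hr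
  have hs0 : s ≠ 0 := by rintro rfl; exact hr (by simpa using hp)
  have hs1 : s ≠ 1 := by rintro rfl; exact hr (by simpa using hq)
  have hs' : s ∈ Ioo (0 : ℝ) 1 := ⟨lt_of_le_of_ne hs.1 hs0.symm, lt_of_le_of_ne hs.2 hs1⟩
  obtain ⟨hf0, hpos⟩ := hpos p hp q hq s hs' (hcl s hs) hr
  have hv : q - p ≠ 0 := by
    intro h
    rw [sub_eq_zero.1 h] at hr
    exact hr (by simpa using hp)
  have hline : ∀ t : ℝ, HasDerivAt (fun t : ℝ => (AffineMap.lineMap p q t : E4)) (q - p) t :=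
    fun t => AffineMap.hasDerivAt_lineMap
  have h1 : ∀ t : ℝ, HasDerivAt (fun t : ℝ => f (AffineMap.lineMap p q t))
      (inner ℝ (g (AffineMap.lineMap p q t)) (q - p)) t := by
    intro t
    have := (hasGradientAt_iff_hasFDerivAt.1 (hg (AffineMap.lineMap p q t))).comp_hasDerivAt t (hline t)
    simpa only [toDual_apply_apply, Function.comp_def] using this
  have h2 : HasDerivAt (fun t : ℝ => inner ℝ (g (AffineMap.lineMap p q t)) (q - p))
      (inner ℝ (A (AffineMap.lineMap p q s) (q - p)) (q - p)) s := by
    have := ((hA (AffineMap.lineMap p q s)).comp_hasDerivAt s (hline s)).inner ℝ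
      (hasDerivAt_const s (q - p))
    simpa using this
  have hmax : IsLocalMax (fun t : ℝ => f (AffineMap.lineMap p q t)) s := by
    filter_upwards [Icc_mem_nhds hs'.1 hs'.2] with t ht
    rw [hf0]
    exact hle _ (hcl t ht)
  have hcrit := hmax.hasDerivAt_eq_zero (h1 s)
  have hd : deriv (fun t : ℝ => f (AffineMap.lineMap p q t))
      = fun t : ℝ => inner ℝ (g (AffineMap.lineMap p q t)) (q - p) := funext fun t => (h1 t).deriv
  have h2pos := hpos _ hv hcrit
  -- A limit segment touching the boundary yields both a maximum and a minimum of `f` there, so `f`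
  -- is locally constant along it, against the positive second derivative.
  have hmin : IsLocalMin (fun t : ℝ => f (AffineMap.lineMap p q t)) s := by
    apply isLocalMin_of_deriv_deriv_pos
    · rw [hd, h2.deriv]; exact h2pos
    · rw [hd]; exact hcrit
    · exact (h1 s).continuousAt
  have hconst : (fun t : ℝ => f (AffineMap.lineMap p q t)) =ᶠ[nhds s] fun _ => (0 : ℝ) := by
    filter_upwards [hmin, hmax] with t h3 h4
    rw [← hf0]
    exact le_antisymm h4 h3
  have h5 := (hconst.deriv).deriv_eq
  rw [hd, h2.deriv] at h5
  rw [deriv_const', deriv_const] at h5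
  exact h2pos.ne' h5

/-! ### The potential well around a collision -/

/-- The bounded component of the sublevel set around the collision `x = 0`. -/
def energyWell (E : ℝ) : Set E4 :=
  {z | regHamiltonian (1 / 2) E z < 0 ∧ |z 3| < π / 2 ∧ cosh (z 2) < 2}

/-- The boundary of `energyWell E`. -/
def energyWall (E : ℝ) : Set E4 :=
  {z | regHamiltonian (1 / 2) E z = 0 ∧ |z 3| ≤ π / 2 ∧ cosh (z 2) ≤ 2}

variable {E : ℝ} {z : E4}

theorem continuous_regHamiltonian (E : ℝ) : Continuous (regHamiltonian (1 / 2) E) :=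
  continuous_iff_continuousAt.2 fun z => (hasGradientAt_regHamiltonian E z).continuousAt

theorem continuous_coord (i : Fin 4) : Continuous fun z : E4 => z i :=
  (EuclideanSpace.proj i : E4 →L[ℝ] ℝ).continuous

theorem isOpen_energyWell (E : ℝ) : IsOpen (energyWell E) :=
  (isOpen_lt (continuous_regHamiltonian E) continuous_const).inter
    ((isOpen_lt (continuous_coord 3).abs continuous_const).inter
      (isOpen_lt (continuous_cosh.comp (continuous_coord 2)) continuous_const))

theorem isClosed_energyWall (E : ℝ) : IsClosed (energyWall E) :=
  (isClosed_eq (continuous_regHamiltonian E) continuous_const).inter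
    ((isClosed_le (continuous_coord 3).abs continuous_const).inter
      (isClosed_le (continuous_cosh.comp (continuous_coord 2)) continuous_const))

theorem hypPotential_lower_bound {e x : ℝ} (he : 1 / 2 ≤ e) (hc : cosh x ≤ 2) :
    e - 1 / 2 + (cosh x - 1) / 4 ≤ hypPotential e x := by
  rw [hypPotential_eq]
  have h1 := one_le_cosh x
  set C := cosh x
  have h2 : 0 ≤ (C - 1) * ((e - 1 / 2) * (C + 1) + (C / 2 - 1 / 4) - C ^ 2 * (C + 1) / 32) := by
    apply mul_nonneg (by linarith)
    have := mul_nonneg (sub_nonneg.2 he) (by linarith : 0 ≤ C + 1)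
    have h3 : 0 ≤ C * (2 - C) := mul_nonneg (by linarith) (by linarith)
    have h4 := mul_nonneg (by linarith : 0 ≤ C) h3
    linarith
  linarith

theorem hypPotential_mono {e x y : ℝ} (he : 1 / 2 ≤ e) (hxy : cosh x ≤ cosh y) (hc : cosh y ≤ 2) :
    hypPotential e x + (cosh y - cosh x) / 4 ≤ hypPotential e y := by
  rw [hypPotential_eq, hypPotential_eq]
  have h1 := one_le_cosh x
  set C := cosh x
  set D := cosh y
  have h2 : 0 ≤ (D - C) * ((e - 1 / 2) * (D + C) + ((D + C) / 2 - 3 / 4)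
      - (D + C) * (D ^ 2 + C ^ 2 - 1) / 32) := by
    apply mul_nonneg (by linarith)
    have h3 := mul_nonneg (sub_nonneg.2 he) (by linarith : 0 ≤ D + C)
    have h4 : D ^ 2 + C ^ 2 - 1 ≤ 7 := by nlinarith
    have h5 := mul_le_mul_of_nonneg_left h4 (by linarith : 0 ≤ D + C)
    rcases le_total 3 (D + C) with h6 | h6
    · linarith
    · have h7 : D ^ 2 + C ^ 2 - 1 ≤ 4 := by
        nlinarith [mul_nonneg (by linarith : 0 ≤ C - 1) (by linarith : 0 ≤ D - 1)]
      have h8 := mul_le_mul_of_nonneg_left h7 (by linarith : 0 ≤ D + C)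
      linarith
  linarith

theorem trigPotential_mono {e x y : ℝ} (he : 1 / 2 ≤ e) (hxy : cos y ^ 2 ≤ cos x ^ 2) :
    trigPotential e x + (cos x ^ 2 - cos y ^ 2) / 4 ≤ trigPotential e y := by
  rw [trigPotential_eq, trigPotential_eq]
  have h1 := cos_sq_le_one x
  have h2 := cos_sq_le_one y
  have h3 := sq_nonneg (cos x)
  have h4 := sq_nonneg (cos y)
  set k := cos x ^ 2
  set l := cos y ^ 2
  have : 0 ≤ (k - l) * (e - 1 / 4 + (1 - k - l) / 32) := by
    apply mul_nonneg <;> linarith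
  linarith

/-- The potential barrier: `V = 4e - 11/8` there and `W ≥ -e`, so the sum is at least `3e - 11/8 >
0`. -/
theorem regHamiltonian_pos_of_cosh_eq_two (hE : E ≤ -2) (h : cosh (z 2) = 2) :
    0 < regHamiltonian (1 / 2) E z := by
  have h1 := trigPotential_ge (-E / 4) (z 3) (by linarith)
  have h2 := sq_nonneg (shearedMomentum₁ z)
  have h3 := sq_nonneg (shearedMomentum₂ z)
  rw [regHamiltonian_half, hypPotential_eq, h]
  linarith

theorem trigPotential_of_cos_eq_zero {e x : ℝ} (h : cos x = 0) : trigPotential e x = 0 := by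
  rw [trigPotential_eq, h]; ring

/-- Where `W` vanishes, all remaining summands are nonnegative because `V ≥ e - 1/2 + (cosh x₁ -
1)/4`. The zero level can thus reach `|x₂| = π/2` only at the Lagrange energy, over the Lagrange
point. -/
theorem eq_zero_of_cos_eq_zero (hE : E ≤ -2) (hc : cosh (z 2) ≤ 2) (hk : cos (z 3) = 0)
    (h : regHamiltonian (1 / 2) E z ≤ 0) :
    z 0 = 0 ∧ z 1 = 0 ∧ z 2 = 0 ∧ E = -2 ∧ regHamiltonian (1 / 2) E z = 0 := by
  rw [regHamiltonian_half, trigPotential_of_cos_eq_zero hk] at h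
  have h1 := hypPotential_lower_bound (e := -E / 4) (by linarith) hc
  have h2 := sq_nonneg (shearedMomentum₁ z)
  have h3 := sq_nonneg (shearedMomentum₂ z)
  have h4 := one_le_cosh (z 2)
  have h5 : shearedMomentum₁ z = 0 := pow_eq_zero_iff two_ne_zero |>.1 (by linarith)
  have h6 : shearedMomentum₂ z = 0 := pow_eq_zero_iff two_ne_zero |>.1 (by linarith)
  have h7 : z 2 = 0 := by
    by_contra h0
    have := one_lt_cosh.2 h0
    linarith
  refine ⟨?_, ?_, h7, by linarith, ?_⟩
  · rw [shearedMomentum₁, sin_two_mul, hk] at h5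
    linarith
  · rw [shearedMomentum₂, h7] at h6
    simpa using h6
  · rw [regHamiltonian_half, trigPotential_of_cos_eq_zero hk, h5, h6]
    linarith

theorem cos_ne_zero_of_abs_lt {x : ℝ} (h : |x| < π / 2) : cos x ≠ 0 :=
  (cos_pos_of_mem_Ioo ⟨(abs_lt.1 h).1, (abs_lt.1 h).2⟩).ne'

theorem cos_eq_zero_of_abs_eq {x : ℝ} (h : |x| = π / 2) : cos x = 0 := by
  rw [← cos_abs, h, cos_pi_div_two]

/-! ### Shrinking towards the collision -/

/-- The rescaling of `ℝ⁴` that is linear in the sheared coordinates. -/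
noncomputable def shearedScaling (t : ℝ) (z : E4) : E4 :=
  !₂[t * shearedMomentum₁ z - sin (2 * (t * z 3)) / 8,
    t * shearedMomentum₂ z - sinh (2 * (t * z 2)) / 8, t * z 2, t * z 3]

theorem shearedMomentum₁_shearedScaling (t : ℝ) (z : E4) :
    shearedMomentum₁ (shearedScaling t z) = t * shearedMomentum₁ z := by
  simp [shearedMomentum₁, shearedScaling]

theorem shearedMomentum₂_shearedScaling (t : ℝ) (z : E4) :
    shearedMomentum₂ (shearedScaling t z) = t * shearedMomentum₂ z := by
  simp [shearedMomentum₂, shearedScaling]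

theorem shearedScaling_zero (z : E4) : shearedScaling 0 z = 0 := by
  ext i; fin_cases i <;> simp [shearedScaling]

theorem shearedScaling_one (z : E4) : shearedScaling 1 z = z := by
  ext i; fin_cases i <;> simp [shearedScaling, shearedMomentum₁, shearedMomentum₂]

theorem continuous_shearedScaling (z : E4) : Continuous fun t => shearedScaling t z := by
  refine (PiLp.continuous_toLp 2 _).comp (continuous_pi fun i => ?_)
  fin_cases i <;> simp <;> fun_prop

theorem cosh_mul_le {t x : ℝ} (h0 : 0 ≤ t) (h1 : t ≤ 1) : cosh (t * x) ≤ cosh x := by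
  rw [cosh_le_cosh, abs_mul, abs_of_nonneg h0]
  exact mul_le_of_le_one_left (abs_nonneg x) h1

theorem cos_le_cos_mul {t x : ℝ} (h0 : 0 ≤ t) (h1 : t ≤ 1) (hx : |x| ≤ π / 2) :
    cos x ≤ cos (t * x) := by
  rw [← cos_abs x, ← cos_abs (t * x), abs_mul, abs_of_nonneg h0]
  exact cos_le_cos_of_nonneg_of_le_pi (by positivity) (by linarith [pi_pos])
    (mul_le_of_le_one_left (abs_nonneg x) h1)

theorem cos_sq_le_cos_mul_sq {t x : ℝ} (h0 : 0 ≤ t) (h1 : t ≤ 1) (hx : |x| ≤ π / 2) :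
    cos x ^ 2 ≤ cos (t * x) ^ 2 :=
  pow_le_pow_left₀ (cos_nonneg_of_mem_Icc ⟨(abs_le.1 hx).1, (abs_le.1 hx).2⟩)
    (cos_le_cos_mul h0 h1 hx) 2

/-- The surplus terms are kept so that equality for some `t < 1` forces the point to be the origin;
boundary points therefore move strictly into the well. -/
theorem regHamiltonian_shearedScaling_le (hE : E ≤ -2) {t : ℝ} (h0 : 0 ≤ t) (h1 : t ≤ 1)
    (hc : cosh (z 2) ≤ 2) (hx : |z 3| ≤ π / 2) :
    regHamiltonian (1 / 2) E (shearedScaling t z)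
      + (1 - t ^ 2) * (shearedMomentum₁ z ^ 2 + shearedMomentum₂ z ^ 2) / 2
      + (cosh (z 2) - cosh (t * z 2)) / 4 + (cos (t * z 3) ^ 2 - cos (z 3) ^ 2) / 4
      ≤ regHamiltonian (1 / 2) E z := by
  have e2 : shearedScaling t z 2 = t * z 2 := rfl
  have e3 : shearedScaling t z 3 = t * z 3 := rfl
  rw [regHamiltonian_half, regHamiltonian_half, shearedMomentum₁_shearedScaling,
    shearedMomentum₂_shearedScaling, e2, e3]
  have := hypPotential_mono (e := -E / 4) (by linarith) (cosh_mul_le h0 h1) hc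
  have := trigPotential_mono (e := -E / 4) (by linarith) (cos_sq_le_cos_mul_sq h0 h1 hx)
  linarith

theorem regHamiltonian_zero_neg (E : ℝ) : regHamiltonian (1 / 2) E 0 < 0 := by
  simp [regHamiltonian]
  linarith

theorem zero_mem_energyWell (E : ℝ) : (0 : E4) ∈ energyWell E :=
  ⟨regHamiltonian_zero_neg E, by simp [pi_pos], by simp⟩

theorem shearedScaling_mem_energyWell_of_mem (hE : E ≤ -2) (hz : z ∈ energyWell E) {t : ℝ}
    (h0 : 0 ≤ t) (h1 : t ≤ 1) : shearedScaling t z ∈ energyWell E := by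
  obtain ⟨hH, hx, hc⟩ := hz
  refine ⟨?_, ?_, (cosh_mul_le h0 h1).trans_lt hc⟩
  · have h2 := regHamiltonian_shearedScaling_le hE h0 h1 hc.le hx.le
    have h3 := cosh_mul_le (x := z 2) h0 h1
    have h4 := cos_sq_le_cos_mul_sq h0 h1 hx.le
    have h5 : 0 ≤ (1 - t ^ 2) * (shearedMomentum₁ z ^ 2 + shearedMomentum₂ z ^ 2) :=
      mul_nonneg (sub_nonneg.2 (pow_le_one₀ h0 h1)) (by positivity)
    linarith
  · change |t * z 3| < π / 2
    rw [abs_mul, abs_of_nonneg h0]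
    exact (mul_le_of_le_one_left (abs_nonneg _) h1).trans_lt hx

theorem isPreconnected_energyWell (hE : E ≤ -2) : IsPreconnected (energyWell E) := by
  refine isPreconnected_of_forall 0 fun z hz =>
    ⟨(fun t => shearedScaling t z) '' Icc 0 1, ?_, ⟨0, by simp, shearedScaling_zero z⟩,
      ⟨1, by simp, shearedScaling_one z⟩,
      isPreconnected_Icc.image _ (continuous_shearedScaling z).continuousOn⟩
  rintro _ ⟨t, ht, rfl⟩
  exact shearedScaling_mem_energyWell_of_mem hE hz ht.1 ht.2

theorem shearedScaling_mem_energyWell (hE : E ≤ -2) (hz : z ∈ energyWall E) {t : ℝ}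
    (h0 : 0 ≤ t) (h1 : t < 1) : shearedScaling t z ∈ energyWell E := by
  obtain ⟨hH, hx, hc⟩ := hz
  have hc' : cosh (z 2) < 2 := lt_of_le_of_ne hc fun h =>
    (regHamiltonian_pos_of_cosh_eq_two hE h).ne' hH
  refine ⟨?_, ?_, (cosh_mul_le h0 h1.le).trans_lt hc'⟩
  · have h2 := regHamiltonian_shearedScaling_le hE h0 h1.le hc hx
    have h3 := cosh_mul_le (x := z 2) h0 h1.le
    have h4 := cos_sq_le_cos_mul_sq h0 h1.le hx
    have ht : 0 < 1 - t ^ 2 := sub_pos.2 (pow_lt_one₀ h0 h1 two_ne_zero)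
    have h5 : 0 ≤ (1 - t ^ 2) * (shearedMomentum₁ z ^ 2 + shearedMomentum₂ z ^ 2) :=
      mul_nonneg ht.le (by positivity)
    by_contra hneg
    push Not at hneg
    have h6 : (1 - t ^ 2) * (shearedMomentum₁ z ^ 2 + shearedMomentum₂ z ^ 2) = 0 := by linarith
    have h7 := (mul_eq_zero.1 h6).resolve_left ht.ne'
    have h8 := sq_nonneg (shearedMomentum₁ z)
    have h9 := sq_nonneg (shearedMomentum₂ z)
    have h10 : cosh (z 2) = cosh (t * z 2) := by linarith
    have h11 : cos (z 3) ^ 2 = cos (t * z 3) ^ 2 := by linarith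
    have h12 : z 2 = 0 := by
      by_contra hne
      have : cosh (t * z 2) < cosh (z 2) := by
        rw [cosh_lt_cosh, abs_mul, abs_of_nonneg h0]
        exact mul_lt_of_lt_one_left (abs_pos.2 hne) h1
      exact this.ne h10.symm
    have h13 : z 3 = 0 := by
      by_contra hne
      have hlt : cos (z 3) < cos (t * z 3) := by
        rw [← cos_abs (z 3), ← cos_abs (t * z 3), abs_mul, abs_of_nonneg h0]
        exact cos_lt_cos_of_nonneg_of_le_pi (by positivity) (by linarith [pi_pos])
          (mul_lt_of_lt_one_left (abs_pos.2 hne) h1)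
      have := pow_lt_pow_left₀ hlt (cos_nonneg_of_mem_Icc ⟨(abs_le.1 hx).1, (abs_le.1 hx).2⟩)
        two_ne_zero
      exact this.ne h11
    have h14 : shearedMomentum₁ z = 0 := pow_eq_zero_iff two_ne_zero |>.1 (by linarith)
    have h15 : shearedMomentum₂ z = 0 := pow_eq_zero_iff two_ne_zero |>.1 (by linarith)
    have : z = 0 := by
      simp only [shearedMomentum₁, h13, shearedMomentum₂, h12] at h14 h15
      ext i
      fin_cases i
      · simpa using h14
      · simpa using h15
      · simpa using h12
      · simpa using h13
    rw [this] at hH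
    exact (regHamiltonian_zero_neg E).ne hH
  · change |t * z 3| < π / 2
    rw [abs_mul, abs_of_nonneg h0]
    rcases (abs_nonneg (z 3)).eq_or_lt with h | h
    · rw [← h]; simp [pi_pos]
    · exact (mul_lt_of_lt_one_left h h1).trans_le hx

theorem energyWall_subset_closure (hE : E ≤ -2) : energyWall E ⊆ closure (energyWell E) := by
  intro z hz
  have h1 : (1 : ℝ) ∈ closure (Ico 0 1) := by
    rw [closure_Ico zero_ne_one]; simp
  have := map_mem_closure (continuous_shearedScaling z) h1 (t := energyWell E)
    fun t ht => shearedScaling_mem_energyWell hE hz ht.1 ht.2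
  rwa [shearedScaling_one] at this

theorem closure_energyWell_subset (E : ℝ) : closure (energyWell E) ⊆
    {z | regHamiltonian (1 / 2) E z ≤ 0 ∧ |z 3| ≤ π / 2 ∧ cosh (z 2) ≤ 2} :=
  closure_minimal (fun _ hz => ⟨hz.1.le, hz.2.1.le, hz.2.2.le⟩)
    ((isClosed_le (continuous_regHamiltonian E) continuous_const).inter
    ((isClosed_le (continuous_coord 3).abs continuous_const).inter
      (isClosed_le (continuous_cosh.comp (continuous_coord 2)) continuous_const)))

theorem frontier_energyWell (hE : E ≤ -2) : frontier (energyWell E) = energyWall E := by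
  rw [(isOpen_energyWell E).frontier_eq]
  ext z
  constructor
  · rintro ⟨hz, hz'⟩
    obtain ⟨hH, hx, hc⟩ := closure_energyWell_subset E hz
    refine ⟨?_, hx, hc⟩
    by_contra hne
    have hH' := lt_of_le_of_ne hH hne
    have hc' : cosh (z 2) < 2 := lt_of_le_of_ne hc fun h =>
      (regHamiltonian_pos_of_cosh_eq_two hE h).not_ge hH
    refine hz' ⟨hH', lt_of_le_of_ne hx fun h => ?_, hc'⟩
    exact hne (eq_zero_of_cos_eq_zero hE hc (cos_eq_zero_of_abs_eq h) hH).2.2.2.2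
  · intro hz
    exact ⟨energyWall_subset_closure hE hz, fun h => h.1.ne hz.1⟩

theorem convex_energyWell (hE : E ≤ -2) : Convex ℝ (energyWell E) := by
  refine convex_of_hessian_pos (isOpen_energyWell E) (isPreconnected_energyWell hE)
    (fun z => hasGradientAt_regHamiltonian E z) (fun z => hasFDerivAt_regGradient (-E / 4) z)
    (fun z hz => (closure_energyWell_subset E hz).1) ?_
  intro p hp q hq s hs hcl hnot
  have hr : AffineMap.lineMap p q s ∈ energyWall E := by
    rw [← frontier_energyWell hE, (isOpen_energyWell E).frontier_eq]
    exact ⟨hcl, hnot⟩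
  refine ⟨hr.1, fun v hv hker => ?_⟩
  -- The open slab `|x₂| < π/2` is convex, so interior points of the segment avoid the singular
  -- points, where the Hessian estimate is unavailable.
  have hcos : |(AffineMap.lineMap p q s : E4) 3| < π / 2 := by
    have hp' := abs_lt.1 hp.2.1
    have hq' := abs_lt.1 hq.2.1
    have e : (AffineMap.lineMap p q s : E4) 3 = (1 - s) * p 3 + s * q 3 := by
      simp [AffineMap.lineMap_apply]
      ring
    have hs' : 0 < 1 - s := by linarith [hs.2]
    rw [e, abs_lt]
    constructor
    · nlinarith [mul_pos hs' (by linarith : 0 < p 3 + π / 2), mul_pos hs.1 (by linarith : 0 < q 3 + π / 2)]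
    · nlinarith [mul_pos hs' (by linarith : 0 < π / 2 - p 3), mul_pos hs.1 (by linarith : 0 < π / 2 - q 3)]
  refine regHessian_pos (by linarith) hr.2.2 (cos_ne_zero_of_abs_lt hcos) ?_ hv hker
  rw [← regHamiltonian_half]
  exact hr.1

theorem isBounded_energyWell (hE : E ≤ -2) : Bornology.IsBounded (energyWell E) := by
  rw [isBounded_iff_forall_norm_le]
  refine ⟨√((√(2 * (-E / 4)) + 1 / 8) ^ 2 + (√(2 * (-E / 4)) + sinh 4 / 8) ^ 2 + 2 ^ 2 + (π / 2) ^ 2),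
    fun z hz => ?_⟩
  obtain ⟨hH, hx, hc⟩ := hz
  rw [EuclideanSpace.norm_eq, Fin.sum_univ_four]
  have h1 := hypPotential_lower_bound (e := -E / 4) (by linarith) hc.le
  have h2 := trigPotential_ge (-E / 4) (z 3) (by linarith)
  have h3 := one_le_cosh (z 2)
  rw [regHamiltonian_half] at hH
  have h4 := sq_nonneg (shearedMomentum₁ z)
  have h5 := sq_nonneg (shearedMomentum₂ z)
  have hη : |shearedMomentum₁ z| ≤ √(2 * (-E / 4)) := abs_le_sqrt (by linarith)
  have hζ : |shearedMomentum₂ z| ≤ √(2 * (-E / 4)) := abs_le_sqrt (by linarith)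
  have hz2 : |z 2| ≤ 2 := by
    rw [← abs_of_pos (two_pos : (0 : ℝ) < 2), ← cosh_le_cosh]
    have h6 := quadratic_le_exp_of_nonneg (two_pos.le : (0 : ℝ) ≤ 2)
    have h7 := exp_pos (-2)
    have h8 := cosh_eq 2
    linarith
  have hs : |sinh (2 * z 2)| ≤ sinh 4 := by
    have := abs_le.1 hz2
    rw [abs_le, ← sinh_neg, sinh_le_sinh, sinh_le_sinh]
    constructor <;> linarith
  have hz0 : |z 0| ≤ √(2 * (-E / 4)) + 1 / 8 := by
    have e : z 0 = shearedMomentum₁ z - sin (2 * z 3) / 8 := by rw [shearedMomentum₁]; ring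
    rw [e]
    have := abs_sub (shearedMomentum₁ z) (sin (2 * z 3) / 8)
    have h6 : |sin (2 * z 3) / 8| ≤ 1 / 8 := by
      rw [abs_div, abs_of_pos (by norm_num : (0 : ℝ) < 8)]
      have := abs_sin_le_one (2 * z 3)
      linarith
    linarith
  have hz1 : |z 1| ≤ √(2 * (-E / 4)) + sinh 4 / 8 := by
    have e : z 1 = shearedMomentum₂ z - sinh (2 * z 2) / 8 := by rw [shearedMomentum₂]; ring
    rw [e]
    have := abs_sub (shearedMomentum₂ z) (sinh (2 * z 2) / 8)
    have h6 : |sinh (2 * z 2) / 8| ≤ sinh 4 / 8 := by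
      rw [abs_div, abs_of_pos (by norm_num : (0 : ℝ) < 8)]
      linarith
    linarith
  apply sqrt_le_sqrt
  simp only [Real.norm_eq_abs]
  gcongr

theorem boundsConvex_energyWall (hE : E ≤ -2) : BoundsConvex (energyWall E) := by
  have hconv := convex_energyWell hE
  have hint : (interior (energyWell E)).Nonempty := by
    rw [(isOpen_energyWell E).interior_eq]; exact ⟨0, zero_mem_energyWell E⟩
  have h := hconv.interior_closure_eq_interior_of_nonempty_interior hint
  refine ⟨closure (energyWell E), hconv.closure, ?_, ?_, ?_⟩
  · exact (isBounded_energyWell hE).isCompact_closure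
  · rw [h]; exact hint
  · rw [← frontier_energyWell hE, frontier, h, closure_closure]; rfl

/-! ### Regular points of the zero level -/

/-- A critical point in this range has vanishing sheared momenta, `cosh x₁ = 1` and `cos² x₂ = 1`;
its value is `-1/2`, not `0`. -/
theorem regGradient_ne_zero {e : ℝ} (he : 1 / 2 ≤ e) (hc : cosh (z 2) ≤ 2) (hk : cos (z 3) ≠ 0)
    (h : (shearedMomentum₁ z ^ 2 + shearedMomentum₂ z ^ 2) / 2 + hypPotential e (z 2)
      + trigPotential e (z 3) = 0) : regGradient e z ≠ 0 := by
  intro h0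
  have g0 : shearedMomentum₁ z = 0 := congrArg (fun w : E4 => w 0) h0
  have g1 : shearedMomentum₂ z = 0 := congrArg (fun w : E4 => w 1) h0
  have g2 : shearedMomentum₂ z * cosh (2 * z 2) / 4 + hypPotential' e (z 2) = 0 :=
    congrArg (fun w : E4 => w 2) h0
  have g3 : shearedMomentum₁ z * cos (2 * z 3) / 4 + trigPotential' e (z 3) = 0 :=
    congrArg (fun w : E4 => w 3) h0
  rw [g1, zero_mul, zero_div, zero_add] at g2
  rw [g0, zero_mul, zero_div, zero_add] at g3
  have s2 := hypPotential'_sq e (z 2)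
  have s3 := trigPotential'_sq e (z 3)
  rw [g2, zero_pow two_ne_zero, zero_eq_mul] at s2
  rw [g3, zero_pow two_ne_zero, zero_eq_mul] at s3
  have h1 := one_le_cosh (z 2)
  have hle := cos_sq_le_one (z 3)
  have hcosh : cosh (z 2) = 1 := by
    rcases s2 with s2 | s2
    · nlinarith
    · have s2 := pow_eq_zero_iff two_ne_zero |>.1 s2
      generalize cosh (z 2) = C at *
      have h3 := mul_nonneg (sub_nonneg.2 he) (by linarith : 0 ≤ C)
      have h4 := mul_nonneg (mul_nonneg (by linarith : 0 ≤ C) (by linarith : 0 ≤ 2 - C))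
        (by linarith : 0 ≤ 2 + C)
      linarith
  have hcos : cos (z 3) ^ 2 = 1 := by
    rcases s3 with s3 | s3
    · have := pow_ne_zero 2 hk
      rcases mul_eq_zero.1 s3 with s3 | s3
      · exact absurd s3 (mul_ne_zero four_ne_zero this)
      · linarith
    · have s3 := pow_eq_zero_iff two_ne_zero |>.1 s3
      linarith
  rw [g0, g1, hypPotential_eq, trigPotential_eq, hcosh, hcos] at h
  linarith

theorem regGradient_eq_zero_of_cos_eq_zero (e : ℝ) (h0 : z 0 = 0) (h1 : z 1 = 0) (h2 : z 2 = 0)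
    (hk : cos (z 3) = 0) : regGradient e z = 0 := by
  have hs : sin (2 * z 3) = 0 := by rw [sin_two_mul, hk, mul_zero]
  ext i
  fin_cases i <;>
    simp [regGradient, shearedMomentum₁, shearedMomentum₂, hypPotential', trigPotential',
      sin_four_mul, hs, h0, h1, h2]

theorem mem_regularPart_iff (hE : E ≤ -2) (hc : cosh (z 2) ≤ 2) :
    z ∈ regularPart (1 / 2) E ↔ regHamiltonian (1 / 2) E z = 0 ∧ cos (z 3) ≠ 0 := by
  rw [regularPart, mem_ofPred_eq, gradient_regHamiltonian]
  refine and_congr_right fun h => ⟨fun hg hk => ?_, fun hk => ?_⟩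
  · obtain ⟨h0, h1, h2, -, -⟩ := eq_zero_of_cos_eq_zero hE hc hk h.le
    exact hg (regGradient_eq_zero_of_cos_eq_zero _ h0 h1 h2 hk)
  · rw [regHamiltonian_half] at h
    exact regGradient_ne_zero (by linarith) hc hk h

theorem contDiff_regGradient (e : ℝ) : ContDiff ℝ 2 (regGradient e) := by
  have hc : ∀ i : Fin 4, ContDiff ℝ 2 fun w : E4 => w i := fun i =>
    (EuclideanSpace.proj i : E4 →L[ℝ] ℝ).contDiff
  have h0 := hc 0
  have h1 := hc 1
  have h2 := hc 2
  have h3 := hc 3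
  have hm (c : ℝ) : ContDiff ℝ 2 fun x : ℝ => c * x := by fun_prop
  have s3 := contDiff_sin.comp ((hm 2).comp h3)
  have s3' := contDiff_sin.comp ((hm 4).comp h3)
  have c3 := contDiff_cos.comp ((hm 2).comp h3)
  have s2 := contDiff_sinh.comp ((hm 2).comp h2)
  have s2'' := contDiff_sinh.comp h2
  have s2' := contDiff_sinh.comp ((hm 4).comp h2)
  have c2 := contDiff_cosh.comp ((hm 2).comp h2)
  have m1 : ContDiff ℝ 2 shearedMomentum₁ := h0.add (s3.div_const 8)
  have m2 : ContDiff ℝ 2 shearedMomentum₂ := h1.add (s2.div_const 8)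
  rw [contDiff_euclidean]
  intro i
  fin_cases i
  · exact m1
  · exact m2
  · exact ((m2.mul c2).div_const 4).add
      (((contDiff_const.mul s2).sub (s2''.div_const 2)).sub (s2'.div_const 64))
  · exact ((m1.mul c3).div_const 4).add ((contDiff_const.mul s3).sub (s3'.div_const 64))

theorem inner_regHessian_comm (e : ℝ) (z u v : E4) :
    inner ℝ (regHessian e z u) v = inner ℝ (regHessian e z v) u := by
  simp [regHessian, PiLp.inner_apply, Fin.sum_univ_four]
  ring

theorem hasPositiveCurvatureAt_regHamiltonian (hE : E ≤ -2) (hc : cosh (z 2) ≤ 2)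
    (hk : cos (z 3) ≠ 0) (h : regHamiltonian (1 / 2) E z = 0) :
    HasPositiveCurvatureAt (regHamiltonian (1 / 2) E) z := by
  have he : 1 / 2 ≤ -E / 4 := by linarith
  have hf : fderiv ℝ (gradient (regHamiltonian (1 / 2) E)) z = regHessian (-E / 4) z := by
    rw [gradient_regHamiltonian]
    exact (hasFDerivAt_regGradient _ z).fderiv
  rw [regHamiltonian_half] at h
  apply hasPositiveCurvatureAt_of_hessian_pos
  · rw [gradient_regHamiltonian]
    exact (contDiff_regGradient _).contDiffAt
  · rw [gradient_regHamiltonian]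
    exact regGradient_ne_zero he hc hk h
  · intro u v
    rw [hf]
    exact inner_regHessian_comm _ z u v
  · intro v hv hker
    rw [hf]
    rw [gradient_regHamiltonian] at hker
    exact regHessian_pos he hc hk h hv hker

/-! ### The component of the regular points around a collision -/

/-- The regular part of `energyWall E`. -/
def energySheet (E : ℝ) : Set E4 :=
  {z | regHamiltonian (1 / 2) E z = 0 ∧ |z 3| < π / 2 ∧ cosh (z 2) < 2}

/-- The `x₂`-axis. -/
def axis : Submodule ℝ E4 := Submodule.span ℝ {EuclideanSpace.single 3 1}

theorem mem_axis_iff : z ∈ axis ↔ z 0 = 0 ∧ z 1 = 0 ∧ z 2 = 0 := by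
  rw [axis, Submodule.mem_span_singleton]
  constructor
  · rintro ⟨a, rfl⟩
    simp
  · rintro ⟨h0, h1, h2⟩
    refine ⟨z 3, ?_⟩
    ext i
    fin_cases i <;> simp [h0, h1, h2]

/-- The axis has codimension three, and any singular points of the wall lie on it; removing it
therefore does not disconnect. -/
theorem isPathConnected_compl_axis : IsPathConnected ((axis : Set E4)ᶜ) := by
  apply isPathConnected_compl_of_one_lt_codim
  rw [← Module.finrank_eq_rank]
  have h1 := axis.finrank_quotient_add_finrank
  have h2 : Module.finrank ℝ axis = 1 := finrank_span_singleton (by simp)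
  rw [finrank_euclideanSpace, Fintype.card_fin] at h1
  have : Module.finrank ℝ (E4 ⧸ axis) = 3 := by omega
  rw [this]
  norm_num

theorem energyWell_mem_nhds_zero (E : ℝ) : energyWell E ∈ nhds (0 : E4) :=
  (isOpen_energyWell E).mem_nhds (zero_mem_energyWell E)

theorem continuous_gauge_energyWell (hE : E ≤ -2) : Continuous (gauge (energyWell E)) :=
  continuous_gauge (convex_energyWell hE) (energyWell_mem_nhds_zero E)

theorem gauge_energyWell_pos (hE : E ≤ -2) (hz : z ≠ 0) : 0 < gauge (energyWell E) z :=
  (gauge_pos (absorbent_nhds_zero (energyWell_mem_nhds_zero E))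
    (NormedSpace.isVonNBounded_iff ℝ |>.2 (isBounded_energyWell hE))).2 hz

theorem gauge_energyWell_eq_one_iff (hE : E ≤ -2) :
    gauge (energyWell E) z = 1 ↔ z ∈ energyWall E := by
  rw [gauge_eq_one_iff_mem_frontier (convex_energyWell hE) (energyWell_mem_nhds_zero E),
    frontier_energyWell hE]

/-- The radial projection to `energyWall E`. -/
noncomputable def radialProjection (E : ℝ) (z : E4) : E4 := (gauge (energyWell E) z)⁻¹ • z

theorem radialProjection_mem (hE : E ≤ -2) (hz : z ≠ 0) : radialProjection E z ∈ energyWall E := by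
  have h := gauge_energyWell_pos hE hz
  rw [← gauge_energyWell_eq_one_iff hE, radialProjection, gauge_smul_of_nonneg (by positivity),
    smul_eq_mul, inv_mul_cancel₀ h.ne']

theorem radialProjection_of_mem (hE : E ≤ -2) (hz : z ∈ energyWall E) :
    radialProjection E z = z := by
  rw [radialProjection, (gauge_energyWell_eq_one_iff hE).2 hz, inv_one, one_smul]

theorem continuousAt_radialProjection (hE : E ≤ -2) (hz : z ≠ 0) :
    ContinuousAt (radialProjection E) z :=
  ((continuous_gauge_energyWell hE).continuousAt.inv₀ (gauge_energyWell_pos hE hz).ne').smul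
    continuousAt_id

theorem mem_energySheet_of_not_mem_axis (hE : E ≤ -2) (hz : z ∈ energyWall E) (h : z ∉ axis) :
    z ∈ energySheet E := by
  obtain ⟨hH, hx, hc⟩ := hz
  refine ⟨hH, lt_of_le_of_ne hx fun h' => h ?_, lt_of_le_of_ne hc fun h' => ?_⟩
  · obtain ⟨h0, h1, h2, -, -⟩ := eq_zero_of_cos_eq_zero hE hc (cos_eq_zero_of_abs_eq h') hH.le
    exact mem_axis_iff.2 ⟨h0, h1, h2⟩
  · exact (regHamiltonian_pos_of_cosh_eq_two hE h').ne' hH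

theorem ne_zero_of_mem_energyWall (hz : z ∈ energyWall E) : z ≠ 0 := by
  rintro rfl
  exact (regHamiltonian_zero_neg E).ne hz.1

theorem ne_zero_of_not_mem_axis (h : z ∉ axis) : z ≠ 0 := fun h0 => h (h0 ▸ axis.zero_mem)

theorem image_radialProjection_subset (hE : E ≤ -2) :
    radialProjection E '' (axis : Set E4)ᶜ ⊆ energySheet E := by
  rintro _ ⟨z, hz, rfl⟩
  have hz0 := ne_zero_of_not_mem_axis hz
  refine mem_energySheet_of_not_mem_axis hE (radialProjection_mem hE hz0) fun h => hz ?_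
  exact (axis.smul_mem_iff (inv_ne_zero (gauge_energyWell_pos hE hz0).ne')).1 h

theorem energyWall_subset_closure_image (hE : E ≤ -2) :
    energyWall E ⊆ closure (radialProjection E '' (axis : Set E4)ᶜ) := by
  intro z hz
  by_cases h : z ∈ axis
  · have hz0 := ne_zero_of_mem_energyWall hz
    -- A wall point on the axis is approached by pushing it off the axis in the direction `y₁` and
    -- projecting back.
    have hcont : ContinuousAt (fun t : ℝ => radialProjection E (z + t • EuclideanSpace.single 0 1))
        0 := by
      have hline : Continuous fun t : ℝ => z + t • (EuclideanSpace.single 0 1 : E4) := by fun_prop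
      refine ContinuousAt.comp (g := radialProjection E) ?_ hline.continuousAt
      simpa using continuousAt_radialProjection hE hz0
    have hlim : Filter.Tendsto
        (fun t : ℝ => radialProjection E (z + t • EuclideanSpace.single 0 1))
        (nhdsWithin 0 {0}ᶜ) (nhds z) := by
      have := hcont.tendsto
      simp only [zero_smul, add_zero, radialProjection_of_mem hE hz] at this
      exact this.mono_left nhdsWithin_le_nhds
    refine mem_closure_of_tendsto hlim ?_
    filter_upwards [self_mem_nhdsWithin] with t ht
    refine ⟨_, fun h' => ht ?_, rfl⟩
    have h1 := (mem_axis_iff.1 h).1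
    have h2 := (mem_axis_iff.1 h').1
    simpa [h1] using h2
  · exact subset_closure ⟨z, h, radialProjection_of_mem hE hz⟩

theorem energySheet_subset_energyWall (E : ℝ) : energySheet E ⊆ energyWall E :=
  fun _ hz => ⟨hz.1, hz.2.1.le, hz.2.2.le⟩

theorem closure_energySheet (hE : E ≤ -2) : closure (energySheet E) = energyWall E :=
  (closure_minimal (energySheet_subset_energyWall E) (isClosed_energyWall E)).antisymm
    ((energyWall_subset_closure_image hE).trans (closure_mono (image_radialProjection_subset hE)))

/-- The sheet lies between the connected image of the complement of the axis and the closure of that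
image. -/
theorem isPreconnected_energySheet (hE : E ≤ -2) : IsPreconnected (energySheet E) :=
  (isPathConnected_compl_axis.isConnected.isPreconnected.image _ fun _ hz =>
    (continuousAt_radialProjection hE (ne_zero_of_not_mem_axis hz)).continuousWithinAt).subset_closure
    (image_radialProjection_subset hE)
    ((energySheet_subset_energyWall E).trans (energyWall_subset_closure_image hE))

/-- A component cannot leave the region `|x₂| < π/2`, `cosh x₁ < 2`: on its boundary, zeros with
`cos x₂ = 0` are critical, and `cosh x₁ = 2` is the barrier. -/
theorem connectedComponentIn_regularPart (hE : E ≤ -2) (hz : z ∈ energySheet E) :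
    connectedComponentIn (regularPart (1 / 2) E) z = energySheet E := by
  have hsub : energySheet E ⊆ regularPart (1 / 2) E := fun w hw =>
    (mem_regularPart_iff hE hw.2.2.le).2 ⟨hw.1, cos_ne_zero_of_abs_lt hw.2.1⟩
  refine Subset.antisymm ?_ ((isPreconnected_energySheet hE).subset_connectedComponentIn hz hsub)
  have hC := connectedComponentIn_subset (regularPart (1 / 2) E) z
  have hu : IsOpen {w : E4 | |w 3| < π / 2 ∧ cosh (w 2) < 2} :=
    (isOpen_lt (continuous_coord 3).abs continuous_const).inter
      (isOpen_lt (continuous_cosh.comp (continuous_coord 2)) continuous_const)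
  have hcl : closure {w : E4 | |w 3| < π / 2 ∧ cosh (w 2) < 2} ⊆
      {w : E4 | |w 3| ≤ π / 2 ∧ cosh (w 2) ≤ 2} :=
    closure_minimal (fun _ hw => ⟨hw.1.le, hw.2.le⟩)
      ((isClosed_le (continuous_coord 3).abs continuous_const).inter
        (isClosed_le (continuous_cosh.comp (continuous_coord 2)) continuous_const))
  have := (isPreconnected_connectedComponentIn (F := regularPart (1 / 2) E) (x := z)
    ).subset_of_closure_inter_subset hu ⟨z, mem_connectedComponentIn (hsub hz), hz.2⟩ (by
      rintro w ⟨hw, hwC⟩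
      obtain ⟨hx, hc⟩ := hcl hw
      have hr := (mem_regularPart_iff hE hc).1 (hC hwC)
      exact ⟨lt_of_le_of_ne hx fun h => hr.2 (cos_eq_zero_of_abs_eq h),
        lt_of_le_of_ne hc fun h => (regHamiltonian_pos_of_cosh_eq_two hE h).ne' hr.1⟩)
  exact fun w hw => ⟨(hC hw).1, this hw⟩

/-! ### Translations by multiples of `π` -/

/-- The translation by `kπ` along the `x₂`-axis. -/
noncomputable def axisShift (k : ℤ) : E4 ≃ₜ E4 :=
  Homeomorph.addRight (EuclideanSpace.single 3 (k * π))

theorem axisShift_apply (k : ℤ) (z : E4) : axisShift k z = z + EuclideanSpace.single 3 (k * π) :=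
  rfl

theorem axisShift_apply_three (k : ℤ) (z : E4) : axisShift k z 3 = z 3 + k * π := by
  simp [axisShift_apply]

theorem axisShift_apply_of_ne (k : ℤ) (z : E4) {i : Fin 4} (hi : i ≠ 3) : axisShift k z i = z i := by
  simp [axisShift_apply, hi]

theorem sin_two_mul_add_int_mul_pi (k : ℤ) (x : ℝ) : sin (2 * (x + k * π)) = sin (2 * x) := by
  rw [← sin_add_int_mul_two_pi (2 * x) k]; ring_nf

theorem cos_two_mul_add_int_mul_pi (k : ℤ) (x : ℝ) : cos (2 * (x + k * π)) = cos (2 * x) := by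
  rw [← cos_add_int_mul_two_pi (2 * x) k]; ring_nf

theorem cos_add_int_mul_pi_sq (k : ℤ) (x : ℝ) : cos (x + k * π) ^ 2 = cos x ^ 2 := by
  rw [cos_sq, cos_sq, cos_two_mul_add_int_mul_pi]

/-- Translation by `π` lifts `(p, q) ↦ -(p, q)`, which exchanges the two equal masses. One model
component thus serves both primaries. -/
theorem regHamiltonian_axisShift (k : ℤ) (E : ℝ) (z : E4) :
    regHamiltonian (1 / 2) E (axisShift k z) = regHamiltonian (1 / 2) E z := by
  simp only [regHamiltonian_half, shearedMomentum₁, shearedMomentum₂, trigPotential,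
    axisShift_apply_three, sin_two_mul_add_int_mul_pi, cos_add_int_mul_pi_sq,
    axisShift_apply_of_ne k z (by decide : (0 : Fin 4) ≠ 3),
    axisShift_apply_of_ne k z (by decide : (1 : Fin 4) ≠ 3),
    axisShift_apply_of_ne k z (by decide : (2 : Fin 4) ≠ 3)]

theorem regGradient_axisShift (k : ℤ) (e : ℝ) (z : E4) :
    regGradient e (axisShift k z) = regGradient e z := by
  simp only [regGradient, shearedMomentum₁, shearedMomentum₂, trigPotential', sin_four_mul,
    axisShift_apply_three, sin_two_mul_add_int_mul_pi, cos_two_mul_add_int_mul_pi,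
    axisShift_apply_of_ne k z (by decide : (0 : Fin 4) ≠ 3),
    axisShift_apply_of_ne k z (by decide : (1 : Fin 4) ≠ 3),
    axisShift_apply_of_ne k z (by decide : (2 : Fin 4) ≠ 3)]

theorem axisShift_mem_regularPart_iff (k : ℤ) :
    axisShift k z ∈ regularPart (1 / 2) E ↔ z ∈ regularPart (1 / 2) E := by
  simp only [regularPart, mem_ofPred_eq, gradient_regHamiltonian, regHamiltonian_axisShift,
    regGradient_axisShift]

theorem image_axisShift_regularPart (k : ℤ) (E : ℝ) :
    axisShift k '' regularPart (1 / 2) E = regularPart (1 / 2) E := by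
  ext z
  constructor
  · rintro ⟨w, hw, rfl⟩
    exact (axisShift_mem_regularPart_iff k).2 hw
  · intro hz
    refine ⟨(axisShift k).symm z, ?_, (axisShift k).apply_symm_apply z⟩
    rwa [← axisShift_mem_regularPart_iff k, (axisShift k).apply_symm_apply]

theorem collision_coords {a : Primary} (h1 : ellipticQ₁ (1 / 2) z = a.abscissa (1 / 2))
    (h2 : ellipticQ₂ z = 0) : z 2 = 0 ∧ ∃ k : ℤ, z 3 = k * π := by
  have h3 : (cosh (z 2) * cos (z 3)) ^ 2 = 1 := by
    have : cosh (z 2) * cos (z 3) = 2 * a.abscissa (1 / 2) := by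
      rw [ellipticQ₁] at h1; linarith
    rw [this]
    cases a <;> norm_num [Primary.abscissa]
  have h4 : sinh (z 2) ^ 2 * sin (z 3) ^ 2 = 0 := by
    rw [ellipticQ₂] at h2
    rw [← mul_pow, pow_eq_zero_iff two_ne_zero]
    linarith
  have hs := sinh_sq (z 2)
  have ht := sin_sq (z 3)
  have hc := one_le_cosh (z 2)
  have hk := cos_sq_le_one (z 3)
  rw [mul_pow] at h3
  rw [hs, ht] at h4
  have h5 : cosh (z 2) ^ 2 = 1 := by nlinarith
  have h6 : cos (z 3) ^ 2 = 1 := by rw [h5, one_mul] at h3; exact h3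
  constructor
  · rw [← sinh_eq_zero, ← pow_eq_zero_iff two_ne_zero, hs, h5, sub_self]
  · have : sin (z 3) = 0 := by rw [← pow_eq_zero_iff two_ne_zero, ht, h6, sub_self]
    obtain ⟨k, hk⟩ := sin_eq_zero_iff.1 this
    exact ⟨k, hk.symm⟩

theorem IsLiftedComponent.exists_eq_image {a : Primary} {M : Set E4} (hE : E ≤ -2)
    (hM : IsLiftedComponent (1 / 2) E a M) : ∃ k : ℤ, M = axisShift k '' energyWall E := by
  obtain ⟨z, hz, h1, h2, rfl⟩ := hM
  obtain ⟨h3, k, hk⟩ := collision_coords h1 h2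
  refine ⟨k, ?_⟩
  set w := (axisShift k).symm z
  have hw : axisShift k w = z := (axisShift k).apply_symm_apply z
  have hw2 : w 2 = 0 := by
    rw [← h3, ← hw, axisShift_apply_of_ne k w (by decide)]
  have hw3 : w 3 = 0 := by
    have := axisShift_apply_three k w
    rw [hw, hk] at this
    linarith
  rw [← hw, axisShift_mem_regularPart_iff] at hz
  have hwm : w ∈ energySheet E := ⟨hz.1, by simp [hw3, pi_pos], by simp [hw2]⟩
  rw [← closure_energySheet hE, (axisShift k).image_closure, ← connectedComponentIn_regularPart hE hwm,
    (axisShift k).image_connectedComponentIn hz, image_axisShift_regularPart, hw]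

theorem BoundsConvex.image_axisShift {M : Set E4} (h : BoundsConvex M) (k : ℤ) :
    BoundsConvex (axisShift k '' M) := by
  obtain ⟨B, hconv, hcomp, hint, rfl⟩ := h
  refine ⟨axisShift k '' B, ?_, hcomp.image (axisShift k).continuous, ?_, ?_⟩
  · have h := hconv.translate (EuclideanSpace.single 3 (k * π))
    simp only [add_comm] at h
    exact h
  · rw [← (axisShift k).image_interior]
    exact hint.image _
  · rw [(axisShift k).image_frontier]

theorem exists_isLiftedComponent (E : ℝ) (a : Primary) : ∃ M, IsLiftedComponent (1 / 2) E a M := by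
  -- At the collision `x = 0` the zero level is `|y|² = 1`; `k = 0` lies over the moon and `k = 1`
  -- over the earth.
  have key (k : ℤ) : axisShift k (EuclideanSpace.single 0 1) ∈ regularPart (1 / 2) E := by
    rw [axisShift_mem_regularPart_iff, regularPart, mem_ofPred_eq, gradient_regHamiltonian]
    refine ⟨?_, fun h => ?_⟩
    · simp [regHamiltonian]
      ring
    · have := congrArg (fun w : E4 => w 0) h
      simp [regGradient, shearedMomentum₁] at this
  cases a
  · refine ⟨_, _, key 1, ?_, ?_, rfl⟩
    · simp [ellipticQ₁, Primary.abscissa, axisShift_apply]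
      norm_num
    · simp [ellipticQ₂, axisShift_apply]
  · refine ⟨_, _, key 0, ?_, ?_, rfl⟩
    · simp [ellipticQ₁, Primary.abscissa, axisShift_apply]
      norm_num
    · simp [ellipticQ₂, axisShift_apply]

/-! ### The first Lagrange point -/

theorem hasDerivAt_half_div_sqrt {a : ℝ} (ha : 0 < a) :
    HasDerivAt (fun a => 1 / 2 / √a) (-(1 / (4 * √a ^ 3))) a := by
  have hs := sqrt_pos.2 ha
  refine (((hasDerivAt_sqrt ha.ne').inv hs.ne').const_mul (1 / 2)).congr_deriv ?_ |>.congr_of_eventuallyEq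
    (Filter.Eventually.of_forall fun x => ?_)
  · field_simp
    norm_num
  · simp [div_eq_mul_inv]

theorem hasGradientAt_hamiltonian_half {l : E4} (h3 : l 3 = 0) (hl : -(1 / 2) < l 2)
    (hr : l 2 < 1 / 2) : HasGradientAt (hamiltonian (1 / 2))
      !₂[l 0, l 1 + l 2, l 1 - 1 / (2 * (1 / 2 - l 2) ^ 2) + 1 / (2 * (1 / 2 + l 2) ^ 2), -l 0] l := by
  rw [hasGradientAt_iff_hasFDerivAt]
  have c0 := hasFDerivAt_coord 0 l
  have c1 := hasFDerivAt_coord 1 l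
  have c2 := hasFDerivAt_coord 2 l
  have c3 := hasFDerivAt_coord 3 l
  have hA := ((c2.sub_const (1 / 2)).pow 2).add (c3.pow 2)
  have hB := ((c2.add_const (1 / 2)).pow 2).add (c3.pow 2)
  have eA : (l 2 - 1 / 2) ^ 2 + l 3 ^ 2 = (1 / 2 - l 2) ^ 2 := by rw [h3]; ring
  have eB : (l 2 + 1 / 2) ^ 2 + l 3 ^ 2 = (1 / 2 + l 2) ^ 2 := by rw [h3]; ring
  have pA : 0 < 1 / 2 - l 2 := by linarith
  have pB : 0 < 1 / 2 + l 2 := by linarith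
  have sA := hasDerivAt_half_div_sqrt (a := (l 2 - 1 / 2) ^ 2 + l 3 ^ 2) (by rw [eA]; positivity)
  have sB := hasDerivAt_half_div_sqrt (a := (l 2 + 1 / 2) ^ 2 + l 3 ^ 2) (by rw [eB]; positivity)
  have h := (((((c0.sub c3).pow 2).add ((c1.add c2).pow 2)).mul_const (1 / 2)).sub
    (sA.comp_hasFDerivAt l hA)).sub (sB.comp_hasFDerivAt l hB) |>.sub
    (((c2.pow 2).add (c3.pow 2)).mul_const (1 / 2))
  rw [eA, eB, sqrt_sq pA.le, sqrt_sq pB.le] at h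
  refine (h.congr_fderiv ?_).congr_of_eventuallyEq (Filter.Eventually.of_forall fun w => ?_)
  · ext v
    have nA : 1 - 2 * l 2 ≠ 0 := by linarith
    have nB : 1 + 2 * l 2 ≠ 0 := by linarith
    simp [PiLp.inner_apply, Fin.sum_univ_four, h3]
    field_simp
    ring
  · simp only [hamiltonian, Pi.sub_apply, Pi.add_apply, Function.comp]
    norm_num
    ring

theorem isFirstLagrangePoint_half_iff {l : E4} : IsFirstLagrangePoint (1 / 2) l ↔ l = 0 := by
  constructor
  · rintro ⟨h3, hl, hr, hg⟩
    have hr' : l 2 < 1 / 2 := by linarith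
    rw [(hasGradientAt_hamiltonian_half h3 hl hr').gradient] at hg
    have g0 : l 0 = 0 := congrArg (fun w : E4 => w 0) hg
    have g1 : l 1 + l 2 = 0 := congrArg (fun w : E4 => w 1) hg
    have g2 : l 1 - 1 / (2 * (1 / 2 - l 2) ^ 2) + 1 / (2 * (1 / 2 + l 2) ^ 2) = 0 :=
      congrArg (fun w : E4 => w 2) hg
    have pA : 0 < 1 / 2 - l 2 := by linarith
    have pB : 0 < 1 / 2 + l 2 := by linarith
    have g1' : l 1 = -l 2 := by linarith
    rw [g1'] at g2
    -- Clearing denominators in the force balance gives the position times a positive factor, hence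
    -- uniqueness.
    have g4 : l 2 * ((1 / 2 - l 2) ^ 2 * (1 / 2 + l 2) ^ 2 + 1) = 0 := by
      generalize l 2 = q at *
      have e : -q - 1 / (2 * (1 / 2 - q) ^ 2) + 1 / (2 * (1 / 2 + q) ^ 2)
        = -(q * ((1 / 2 - q) ^ 2 * (1 / 2 + q) ^ 2 + 1)) / ((1 / 2 - q) ^ 2 * (1 / 2 + q) ^ 2) := by
        rw [sub_add, div_sub_div _ _ (by positivity) (by positivity), sub_div' (by positivity),
          div_eq_div_iff (by positivity) (by positivity)]
        ring
      rw [e, div_eq_zero_iff, neg_eq_zero] at g2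
      exact g2.resolve_right (by positivity)
    have g5 : l 2 = 0 := (mul_eq_zero.1 g4).resolve_right (by positivity)
    ext i
    fin_cases i
    · simpa using g0
    · simpa [g5] using g1'
    · simpa using g5
    · simpa using h3
  · rintro rfl
    refine ⟨rfl, by norm_num, by norm_num, ?_⟩
    rw [(hasGradientAt_hamiltonian_half (l := 0) rfl (by norm_num) (by norm_num)).gradient]
    ext i
    fin_cases i <;> simp

theorem hamiltonian_half_zero : hamiltonian (1 / 2) 0 = -2 := by
  have h : √((1 / 2 : ℝ) ^ 2) = 1 / 2 := sqrt_sq (by norm_num)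
  simp only [hamiltonian, PiLp.zero_apply]
  norm_num at h ⊢

/-! ### The points over the first Lagrange point -/

theorem isFirstLagrangePoint_ellipticMap_iff :
    IsFirstLagrangePoint (1 / 2) (ellipticMap (1 / 2) z) ↔
      z 0 = 0 ∧ z 1 = 0 ∧ z 2 = 0 ∧ cos (z 3) = 0 := by
  rw [isFirstLagrangePoint_half_iff]
  constructor
  · intro h
    have g0 : 2 / ellipticFactor z * (sinh (z 2) * cos (z 3) * z 0 - cosh (z 2) * sin (z 3) * z 1)
      = 0 := congrArg (fun w : E4 => w 0) h
    have g1 : 2 / ellipticFactor z * (cosh (z 2) * sin (z 3) * z 0 + sinh (z 2) * cos (z 3) * z 1)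
       - (1 / 2 - 1 / 2) = 0 := congrArg (fun w : E4 => w 1) h
    have g2 : (1 / 2 - 1 / 2) + cosh (z 2) * cos (z 3) / 2 = 0 := congrArg (fun w : E4 => w 2) h
    have g3 : sinh (z 2) * sin (z 3) / 2 = 0 := congrArg (fun w : E4 => w 3) h
    have hk : cos (z 3) = 0 := by
      have : cosh (z 2) * cos (z 3) = 0 := by linarith
      exact (mul_eq_zero.1 this).resolve_left (cosh_pos _).ne'
    have hs : sin (z 3) ≠ 0 := fun hs => by
      have := sin_sq_add_cos_sq (z 3)
      rw [hs, hk] at this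
      norm_num at this
    have h2 : z 2 = 0 := by
      have : sinh (z 2) * sin (z 3) = 0 := by linarith
      exact sinh_eq_zero.1 ((mul_eq_zero.1 this).resolve_right hs)
    simp only [ellipticFactor, h2, hk, cosh_zero, sinh_zero] at g0 g1
    norm_num [hs] at g0 g1
    exact ⟨g1, g0, h2, hk⟩
  · rintro ⟨h0, h1, h2, hk⟩
    ext i
    fin_cases i <;> simp [ellipticMap, ellipticQ₁, ellipticQ₂, h0, h1, h2, hk]

theorem cos_axisShift_eq_zero_iff (k : ℤ) : cos (axisShift k z 3) = 0 ↔ cos (z 3) = 0 := by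
  rw [axisShift_apply_three, ← pow_eq_zero_iff two_ne_zero, cos_add_int_mul_pi_sq,
    pow_eq_zero_iff two_ne_zero]

theorem mem_singularSet_image_iff (k : ℤ) {M : Set E4} :
    axisShift k z ∈ singularSet (1 / 2) (axisShift k '' M) ↔
      z ∈ M ∧ z 0 = 0 ∧ z 1 = 0 ∧ z 2 = 0 ∧ cos (z 3) = 0 := by
  rw [singularSet, mem_ofPred_eq, isFirstLagrangePoint_ellipticMap_iff,
    (axisShift k).injective.mem_set_image, cos_axisShift_eq_zero_iff,
    axisShift_apply_of_ne k z (by decide : (0 : Fin 4) ≠ 3),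
    axisShift_apply_of_ne k z (by decide : (1 : Fin 4) ≠ 3),
    axisShift_apply_of_ne k z (by decide : (2 : Fin 4) ≠ 3)]

theorem singularSet_eq_empty (hE : E < -2) (k : ℤ) :
    singularSet (1 / 2) (axisShift k '' energyWall E) = ∅ := by
  rw [eq_empty_iff_forall_notMem]
  intro z hz
  obtain ⟨w, hw, rfl⟩ := hz.1
  have h := ((mem_singularSet_image_iff k).1 hz).2
  exact hE.ne (eq_zero_of_cos_eq_zero hE.le hw.2.2 h.2.2.2 hw.1.le).2.2.2.1

theorem hasPositiveCurvatureAt_of_mem_diff (hE : E ≤ -2) (k : ℤ)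
    (hz : z ∈ (axisShift k '' energyWall E) \ singularSet (1 / 2) (axisShift k '' energyWall E)) :
    HasPositiveCurvatureAt (regHamiltonian (1 / 2) E) z := by
  obtain ⟨⟨w, hw, rfl⟩, hns⟩ := hz
  rw [mem_singularSet_image_iff] at hns
  have hc : cosh (axisShift k w 2) ≤ 2 := by
    rw [axisShift_apply_of_ne k w (by decide)]
    exact hw.2.2
  refine hasPositiveCurvatureAt_regHamiltonian hE hc (fun h => hns ⟨hw, ?_⟩) ?_
  · rw [cos_axisShift_eq_zero_iff] at h
    obtain ⟨h0, h1, h2, -, -⟩ := eq_zero_of_cos_eq_zero hE hw.2.2 h hw.1.le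
    exact ⟨h0, h1, h2, h⟩
  · rw [regHamiltonian_axisShift]
    exact hw.1

theorem singularSet_eq_pair (k : ℤ) :
    singularSet (1 / 2) (axisShift k '' energyWall (-2)) =
      axisShift k '' {EuclideanSpace.single 3 (π / 2), EuclideanSpace.single 3 (-(π / 2))} := by
  have hmem : ∀ x : ℝ, |x| = π / 2 → EuclideanSpace.single 3 x ∈ energyWall (-2) ∧
      cos x = 0 := fun x hx => by
    have hk := cos_eq_zero_of_abs_eq hx
    refine ⟨⟨?_, by simp [hx], by simp⟩, hk⟩
    simp [regHamiltonian, hk, sin_two_mul]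
    norm_num
  have hpi : |π / 2| = π / 2 := abs_of_pos (by positivity)
  ext z
  constructor
  · intro hz
    obtain ⟨w, hw, rfl⟩ := hz.1
    obtain ⟨-, h0, h1, h2, hk⟩ := (mem_singularSet_image_iff k).1 hz
    refine mem_image_of_mem _ ?_
    have h3 : |w 3| = π / 2 := by
      by_contra hne
      exact cos_ne_zero_of_abs_lt (lt_of_le_of_ne hw.2.1 hne) hk
    have hw' : w = EuclideanSpace.single 3 (w 3) := by
      ext i
      fin_cases i <;> simp [h0, h1, h2]
    rw [hw']
    rcases (abs_eq (by positivity)).1 h3 with h | h <;> simp [h]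
  · rintro ⟨w, hw, rfl⟩
    rw [mem_singularSet_image_iff]
    rcases hw with rfl | rfl
    · obtain ⟨h, h'⟩ := hmem _ hpi
      exact ⟨h, by simp, by simp, by simp, by simp [h']⟩
    · obtain ⟨h, h'⟩ := hmem _ ((abs_neg _).trans hpi)
      exact ⟨h, by simp, by simp, by simp, by simp [h']⟩

theorem ncard_singularSet (k : ℤ) :
    (singularSet (1 / 2) (axisShift k '' energyWall (-2))).ncard = 2 := by
  rw [singularSet_eq_pair, ncard_image_of_injective _ (axisShift k).injective, ncard_pair]
  intro h
  have := congrArg (fun w : E4 => w 3) h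
  simp at this
  linarith [pi_pos]

/-! ### Saddle-centers -/

/-- The complex structure `(v₁, v₂) ↦ (-v₂, v₁)` of `ℝ² × ℝ²`. -/
noncomputable def symplecticRotation : E4 →L[ℝ] E4 :=
  LinearMap.toContinuousLinearMap
    { toFun := fun v => !₂[-v 2, -v 3, v 0, v 1]
      map_add' := fun u v => by ext i; fin_cases i <;> simp <;> ring
      map_smul' := fun c v => by ext i; fin_cases i <;> simp }

theorem fderiv_hamiltonianField_regHamiltonian (E : ℝ) (z : E4) :
    fderiv ℝ (hamiltonianField (regHamiltonian (1 / 2) E)) z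
      = symplecticRotation.comp (regHessian (-E / 4) z) := by
  have h : hamiltonianField (regHamiltonian (1 / 2) E)
      = fun w => symplecticRotation (regGradient (-E / 4) w) := by
    funext w
    rw [hamiltonianField, gradient_regHamiltonian]
    rfl
  rw [h]
  exact (symplecticRotation.hasFDerivAt.comp z (hasFDerivAt_regGradient _ z)).fderiv

theorem toMatrix_linearization (h1 : z 1 = 0) (h0 : z 0 = 0) (h2 : z 2 = 0) (hk : cos (z 3) = 0) :
    LinearMap.toMatrix (EuclideanSpace.basisFun (Fin 4) ℝ).toBasis
      (EuclideanSpace.basisFun (Fin 4) ℝ).toBasis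
      (symplecticRotation.comp (regHessian (1 / 2) z) : E4 →ₗ[ℝ] E4)
      = !![0, -1 / 4, -1 / 2, 0; 1 / 4, 0, 0, 1; 1, 0, 0, -1 / 4; 0, 1, 1 / 4, 0] := by
  have hs : sin (2 * z 3) = 0 := by rw [sin_two_mul, hk, mul_zero]
  have hc : cos (2 * z 3) = -1 := by rw [cos_two_mul, hk]; norm_num
  have hc4 : cos (4 * z 3) = 1 := by rw [cos_four_mul, hc]; norm_num
  ext i j
  fin_cases i <;> fin_cases j <;>
    simp [LinearMap.toMatrix_apply, symplecticRotation, regHessian, shearedMomentum₁,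
      shearedMomentum₂, hypPotential'', trigPotential'', h0, h1, h2, hs, hc, hc4] <;> norm_num

/-- The polynomial is `X⁴ - (3/8) X² - 119/256`; as a quadratic in `X²` it has roots `(3 ± 8√2)/16`,
of opposite signs. -/
theorem charpoly_linearization (h0 : z 0 = 0) (h1 : z 1 = 0) (h2 : z 2 = 0) (hk : cos (z 3) = 0) :
    (symplecticRotation.comp (regHessian (1 / 2) z) : E4 →ₗ[ℝ] E4).charpoly =
      (Polynomial.X ^ 2 - Polynomial.C ((8 * √2 + 3) / 16)) *
        (Polynomial.X ^ 2 + Polynomial.C ((8 * √2 - 3) / 16)) := by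
  rw [← LinearMap.charpoly_toMatrix _ (EuclideanSpace.basisFun (Fin 4) ℝ).toBasis,
    toMatrix_linearization h1 h0 h2 hk]
  refine Polynomial.funext fun t => ?_
  have h := sq_sqrt (two_pos.le : (0 : ℝ) ≤ 2)
  rw [Matrix.eval_charpoly]
  simp [Matrix.det_succ_row_zero, Fin.sum_univ_succ, Fin.succAbove]
  linear_combination (1 / 4) * h

theorem isSaddleCenter (h0 : z 0 = 0) (h1 : z 1 = 0) (h2 : z 2 = 0) (hk : cos (z 3) = 0) :
    IsSaddleCenter (regHamiltonian (1 / 2) (-2)) z := by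
  have h := lt_sqrt_of_sq_lt (by norm_num : (1 : ℝ) ^ 2 < 2)
  have hp : 0 < (8 * √2 + 3) / 16 := by linarith
  have hm : 0 < (8 * √2 - 3) / 16 := by linarith
  refine ⟨?_, √((8 * √2 + 3) / 16), √((8 * √2 - 3) / 16), sqrt_pos.2 hp, sqrt_pos.2 hm, ?_⟩
  · rw [gradient_regHamiltonian]
    exact regGradient_eq_zero_of_cos_eq_zero _ h0 h1 h2 hk
  · have e : -(-2) / 4 = (1 / 2 : ℝ) := by norm_num
    rw [fderiv_hamiltonianField_regHamiltonian, sq_sqrt hp.le, sq_sqrt hm.le, e,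
      charpoly_linearization h0 h1 h2 hk]

theorem isStrictlyConvexComponent_half (hE : E ≤ -2) (a : Primary) :
    IsStrictlyConvexComponent (1 / 2) E a := by
  refine ⟨exists_isLiftedComponent E a, fun M hM => ?_⟩
  obtain ⟨k, rfl⟩ := hM.exists_eq_image hE
  exact ⟨(boundsConvex_energyWall hE).image_axisShift k,
    fun z hz => hasPositiveCurvatureAt_of_mem_diff hE k hz⟩

theorem theorem1p7 :
    (∃! l : E4, IsFirstLagrangePoint (1 / 2) l) ∧
    ∀ l : E4, IsFirstLagrangePoint (1 / 2) l →
      hamiltonian (1 / 2) l = -2 ∧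
      ∀ E : ℝ, E ≤ hamiltonian (1 / 2) l →
        IsStrictlyConvexComponent (1 / 2) E Primary.earth ∧
        IsStrictlyConvexComponent (1 / 2) E Primary.moon ∧
        ∀ (a : Primary) (M : Set E4), IsLiftedComponent (1 / 2) E a M →
          (E < hamiltonian (1 / 2) l → singularSet (1 / 2) M = ∅) ∧
          (E = hamiltonian (1 / 2) l →
            (singularSet (1 / 2) M).ncard = 2 ∧
            ∀ z ∈ singularSet (1 / 2) M, IsSaddleCenter (regHamiltonian (1 / 2) E) z) := by
  have h0 : IsFirstLagrangePoint (1 / 2) 0 := isFirstLagrangePoint_half_iff.2 rfl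
  refine ⟨⟨0, h0, fun l => isFirstLagrangePoint_half_iff.1⟩, fun l hl => ?_⟩
  rw [isFirstLagrangePoint_half_iff] at hl
  rw [hl, hamiltonian_half_zero]
  refine ⟨rfl, fun E hE => ⟨isStrictlyConvexComponent_half hE _, isStrictlyConvexComponent_half hE _,
    fun a M hM => ?_⟩⟩
  obtain ⟨k, rfl⟩ := hM.exists_eq_image hE
  refine ⟨fun h => singularSet_eq_empty h k, ?_⟩
  rintro rfl
  refine ⟨ncard_singularSet k, fun z hz => ?_⟩
  obtain ⟨g0, g1, g2, hk⟩ := isFirstLagrangePoint_ellipticMap_iff.1 hz.2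
  exact isSaddleCenter g0 g1 g2 hk
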